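/- \textbf{Conventions.} All semigroups are nonempty. A \emph{pseudovariety} is a class of finite semigroups closed under finite direct products (including the empty product, so that it contains the one-element semigroups), subsemigroups, and homomorphic images. Let $\mathbf{CR}$ be the class of finite completely regular semigroups (finite semigroups that are unions of groups), $\mathbf{LRB}$ the class of finite semigroups satisfying $x^2=x$ and $xyx=xy$, and $\mathbf{RRB}$ the class of finite semigroups satisfying $x^2=x$ and $xyx=yx$. A \emph{normal band} is a semigroup satisfying $x^2=x$ and $uxyv=uyxv$. A finite semigroup $S$ is a \emph{normal band of groups} if, for some normal band $B$, it is a disjoint union of subgroups $S_\alpha$ ($\alpha\in B$) with $S_\alpha S_\beta\subseteq S_{\alpha\beta}$ for all $\alpha,\beta\in B$; the class of these is written $\mathbf{G}\mathbin{\textcircled{m}}\mathbf{NB}$. A \emph{straight-line program} over a subset $\Sigma$ of a semigroup $S$ is a finite sequence of instructions, executed in order on registers $r_1,r_2,\dots$ (arbitrarily many), each of the form $r_k\leftarrow s$ with $s\in\Sigma$, or $r_k\leftarrow r_i\cdot r_j$ where $r_i$ and $r_j$ have been assigned by earlier instructions. Its length is the number of its instructions, and it computes $t\in S$ if some register contains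 $t$ upon completion. Let $c_S(t;\Sigma)$ be the least length of a straight-line program over $\Sigma$ computing $t$. For a class $\mathbf{V}$ of finite semigroups, let $C_{\mathbf V}(N)$ be the maximum of $c_S(t;\Sigma)$ over all $S\in\mathbf{V}$ with $|S|\le N$, all $\Sigma\subseteq S$, and all $t$ in the subsemigroup of $S$ generated by $\Sigma$. We say that $\mathbf{V}$ \emph{admits straight-line programs of length} $\mathcal O(f(N))$ if $C_{\mathbf V}(N)\in\mathcal O(f(N))$ as $N\to\infty$, and that $\mathbf{V}$ \emph{affords efficient compression} if there is a $k\in\mathbb N$ such that $C_{\mathbf V}(N)\in\mathcal O(\log^k N)$. \textbf{Theorem.} Let $\mathbf{V}$ be a pseudovariety with $\mathbf{V}\subseteq\mathbf{CR}$. The following are equivalent. \begin{enumerate} \item The pseudovariety $\mathbf{V}$ affords efficient compression. \item The pseudovariety $\mathbf{V}$ contains neither $\mathbf{LRB}$ nor $\mathbf{RRB}$; that is, $\mathbf{LRB}\not\subseteq\mathbf{V}$ and $\mathbf{RRB}\not\subseteq\mathbf{V}$. \item The pseudovariety $\mathbf{V}$ comprises only normal bands of groups; that is, $\mathbf{V}\subseteq\mathbf{G}\mathbin{\textcircled{m}}\mathbf{NB}$.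 \item The pseudovariety $\mathbf{V}$ admits straight-line programs of length $\mathcal O(\log^2 N)$. \end{enumerate} -/

import Mathlib

open scoped ENNReal

/-! ## Straight-line programs -/

/-- An instruction operating on registers `r_0, r_1, …` that hold elements of `S`:
`assign k s` is `r_k ← s` and `mul k i j` is `r_k ← r_i * r_j`. -/
inductive SLInstr (S : Type) : Type
  | assign (k : ℕ) (s : S) : SLInstr S
  | mul (k i j : ℕ) : SLInstr S

namespace SLInstr

variable {S : Type}

/-- The registers that an instruction operates on. -/
def registers : SLInstr S → Set ℕ
  | assign k _ => {k}
  | mul k i j => {k, i, j}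

/-- Every fixed element that the instruction assigns belongs to `A`. -/
def IsOver (A : Set S) : SLInstr S → Prop
  | assign _ s => s ∈ A
  | mul _ _ _ => True

/-- Execution of one instruction on a register assignment, where `none` is the content of a register
that has not been assigned. The execution fails (with value `none`) if an input register has not
been assigned before. -/
def exec [Mul S] (r : ℕ → Option S) : SLInstr S → Option (ℕ → Option S)
  | assign k s => some (Function.update r k (some s))
  | mul k i j =>
      (r i).bind fun a => (r j).bind fun b => some (Function.update r k (some (a * b)))

end SLInstr

/-- Execution of a sequence of instructions, in order, from a given register assignment. -/
def slRun {S : Type} [Mul S] : List (SLInstr S) → (ℕ → Option S) → Option (ℕ → Option S)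
  | [], r => some r
  | I :: P, r => (I.exec r).bind (slRun P)

/-- The number of registers that a sequence of instructions operates on. -/
noncomputable def slWidth {S : Type} (P : List (SLInstr S)) : ℕ∞ :=
  {k : ℕ | ∃ I ∈ P, k ∈ I.registers}.encard

/-- `P` is a straight-line program over `A` that computes `t`: all assigned elements are from `A`,
input registers are always assigned before their use, and upon completion (starting with no register
assigned) some register contains `t`. -/
def SLComputes {S : Type} [Mul S] (A : Set S) (P : List (SLInstr S)) (t : S) : Prop :=
  (∀ I ∈ P, I.IsOver A) ∧
    ∃ r : ℕ → Option S, slRun P (fun _ => none) = some r ∧ ∃ k, r k = some t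

/-- The straight-line cost `c^w_S(t; A)`: the least length of a straight-line program over `A` of width
at most `w` that computes `t` (`⊤` if there is none). -/
noncomputable def slCost {S : Type} [Mul S] (w : ℕ∞) (A : Set S) (t : S) : ℕ∞ :=
  ⨅ (P : List (SLInstr S)) (_ : SLComputes A P t) (_ : slWidth P ≤ w), (P.length : ℕ∞)

/-- `C^w_S`: the largest straight-line cost `c^w_S(t; A)` with `A ⊆ S` and `t` in the subsemigroup
generated by `A`. -/
noncomputable def slCostMax (w : ℕ∞) (S : Type) [Semigroup S] : ℕ∞ :=
  ⨆ (A : Set S) (t : S) (_ : t ∈ Subsemigroup.closure A), slCost w A t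

/-! ## Classes of semigroups and pseudovarieties -/

/-- A class of semigroups. -/
abbrev SemigroupClass : Type 1 := (S : Type) → [Semigroup S] → Prop

/-- Containment of classes of semigroups. -/
def SemigroupClass.Contained (V W : SemigroupClass) : Prop :=
  ∀ (S : Type) [Semigroup S], V S → W S

/-- A pseudovariety: a class of finite (nonempty) semigroups closed under finite direct products (the
empty one included), nonempty subsemigroups, and homomorphic images. -/
structure IsPseudovariety (V : SemigroupClass) : Prop where
  finite : ∀ (S : Type) [Semigroup S], V S → Finite S
  nonempty : ∀ (S : Type) [Semigroup S], V S → Nonempty S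
  pi : ∀ (ι : Type) [Finite ι] (S : ι → Type) [∀ i, Semigroup (S i)],
    (∀ i, V (S i)) → V (∀ i, S i)
  subsemigroup : ∀ (S : Type) [Semigroup S], V S →
    ∀ T : Subsemigroup S, (T : Set S).Nonempty → V T
  image : ∀ (S T : Type) [Semigroup S] [Semigroup T] (f : S →ₙ* T),
    Function.Surjective f → V S → V T

/-- `C^w_V(N)`: the largest `C^w_S` with `S` in `V` and `|S| ≤ N`. -/
noncomputable def SemigroupClass.slCost (V : SemigroupClass) (w : ℕ∞) (N : ℕ) : ℕ∞ :=
  ⨆ (S : Type) (_ : Semigroup S) (_ : V S) (_ : Nat.card S ≤ N), slCostMax w S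

/-- `V` admits straight-line programs of width `w` and length `O(f(N))`, that is, `C^w_V(N) ∈ O(f(N))`
as `N → ∞`. Unrestricted width is `w = ⊤`. -/
def SemigroupClass.AdmitsSLP (V : SemigroupClass) (w : ℕ∞) (f : ℕ → ℝ) : Prop :=
  ∃ K : ℝ, ∀ᶠ N : ℕ in Filter.atTop,
    ((V.slCost w N : ℕ∞) : ℝ≥0∞) ≤ ENNReal.ofReal (K * |f N|)

/-- `V` affords efficient compression: `C^∞_V(N) ∈ O(log^k N)` for some `k`. -/
def SemigroupClass.EfficientCompression (V : SemigroupClass) : Prop :=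
  ∃ k : ℕ, V.AdmitsSLP ⊤ (fun N => Real.log N ^ k)

/-! ## Particular classes of finite semigroups -/

/-- The semigroup `S` is a group. -/
def IsGroupSemigroup (S : Type) [Semigroup S] : Prop :=
  ∃ (G : Type) (_ : Group G), Nonempty (S ≃* G)

/-- `CR`: finite completely regular semigroups, that is, finite unions of groups. -/
def CR : SemigroupClass := fun S _ =>
  Finite S ∧ Nonempty S ∧ ∀ x : S, ∃ H : Subsemigroup S, x ∈ H ∧ IsGroupSemigroup H

/-- `LRB`: finite left-regular bands. -/
def LRB : SemigroupClass := fun S _ =>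
  Finite S ∧ Nonempty S ∧ (∀ x : S, x * x = x) ∧ ∀ x y : S, x * y * x = x * y

/-- `RRB`: finite right-regular bands. -/
def RRB : SemigroupClass := fun S _ =>
  Finite S ∧ Nonempty S ∧ (∀ x : S, x * x = x) ∧ ∀ x y : S, x * y * x = y * x

/-- `NB`: finite normal bands. -/
def NB : SemigroupClass := fun S _ =>
  Finite S ∧ Nonempty S ∧ (∀ x : S, x * x = x) ∧
    ∀ u x y v : S, u * x * y * v = u * y * x * v

/-- Finite normal bands of groups: for some normal band `B`, there is a partition of `S` into
disjoint subgroups `H α` (`α ∈ B`) with `H α * H β ⊆ H (α * β)`. -/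
def NormalBandsOfGroups : SemigroupClass := fun S _ =>
  Finite S ∧ Nonempty S ∧ ∃ (B : Type) (_ : Semigroup B), NB B ∧
    ∃ H : B → Subsemigroup S,
      (∀ α, IsGroupSemigroup (H α)) ∧
      (∀ x : S, ∃ α, x ∈ H α) ∧
      (∀ α β, α ≠ β → Disjoint (H α : Set S) (H β : Set S)) ∧
      ∀ α β, ∀ x ∈ H α, ∀ y ∈ H β, x * y ∈ H (α * β)

/-!
The lower bound rests on left-regular bands in which products cannot be shortened. In a left-regular
band, repeated factors can be dropped, so a program of length `L` computes a product of at most `L`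
generators. The bands `IntervalBand n` have at most `(n + 1) ^ 2` elements, among them a product of
`n` generators that is not generated by any proper subset of these, so its cost is at least `n`.
Hence a pseudovariety with efficient compression contains neither all left-regular nor, by duality,
all right-regular bands.

The three-element left-regular band `LeftZeroOne` generates all the others, because substitutions
into it detect the order of first occurrence of the letters of a word. So if `V` omits some
left-regular band, no member of `V` has a nontrivial left-zero pair of idempotents below an
idempotent (`leftRigid_of_not_lrb_contained`), and dually for right-zero pairs. In a completely
regular semigroup with both properties, the idempotents of each local submonoid `eSe` commute and
are therefore central there. This makes the relation of belonging to the same maximal subgroup a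
congruence (`IsRigidCR.one_mul_congr`). The quotient is a band in `V`, its local submonoids are
commutative, and a band of this kind is normal (`band_normal`).

For the upper bound, let `φ` map a normal band of groups onto its band, and let `t` be a product of
generators with the first factor `c` and the last factor `d`. The elements `φ c * x * φ d` form a
semilattice, where an irredundant meet has only logarithmically many terms. So a short program
reaches some `e` in the group of `t`, and by taking powers the identity `f` of that group. The
elements `f * a * f` and `f * a * a' * f`, for the generators `a`, `a'` that occur, then generate a
subgroup that contains `t` (`exists_mem_closure_sandwich`), and `O(log²)` further instructions are
enough by the cube-doubling argument of Babai and Szemerédi (`SLReach.of_mem_closure`).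
-/

/-! ### Straight-line programs as growing sets of computed elements -/

/-- `SLExtends A T n U`: once the elements of `T` are available, at most `n` further instructions
over `A`, each writing to a fresh register, make exactly the elements of `U` available. -/
inductive SLExtends {S : Type} [Mul S] (A T : Set S) : ℕ → Set S → Prop
  | refl : SLExtends A T 0 T
  | skip {n : ℕ} {U : Set S} : SLExtends A T n U → SLExtends A T (n + 1) U
  | gen {n : ℕ} {U : Set S} {s : S} :
      SLExtends A T n U → s ∈ A → SLExtends A T (n + 1) (insert s U)
  | mul {n : ℕ} {U : Set S} {a b : S} :
      SLExtends A T n U → a ∈ U → b ∈ U → SLExtends A T (n + 1) (insert (a * b) U)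

/-- `t` becomes available by at most `n` further instructions over `A` as soon as the elements of
`T` are available. -/
def SLReach {S : Type} [Mul S] (A T : Set S) (n : ℕ) (t : S) : Prop :=
  ∃ U, SLExtends A T n U ∧ t ∈ U

section SLExtends

variable {S : Type} [Mul S] {A T U W : Set S} {m n : ℕ} {a b t : S}

theorem SLExtends.subset (h : SLExtends A T n U) : T ⊆ U := by
  induction h with
  | refl => exact subset_rfl
  | skip _ ih => exact ih
  | gen _ _ ih => exact ih.trans (Set.subset_insert _ _)
  | mul _ _ _ ih => exact ih.trans (Set.subset_insert _ _)

theorem SLExtends.trans (h₁ : SLExtends A T m U) (h₂ : SLExtends A U n W) :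
    SLExtends A T (m + n) W := by
  induction h₂ with
  | refl => exact h₁
  | skip _ ih => exact ih.skip
  | gen _ hs ih => exact ih.gen hs
  | mul _ ha hb ih => exact ih.mul ha hb

theorem SLExtends.mono (h : SLExtends A T m U) (hmn : m ≤ n) : SLExtends A T n U := by
  induction n, hmn using Nat.le_induction with
  | base => exact h
  | succ k _ ih => exact ih.skip

theorem SLReach.mono (h : SLReach A T m t) (hmn : m ≤ n) : SLReach A T n t :=
  let ⟨U, hU, ht⟩ := h
  ⟨U, hU.mono hmn, ht⟩

theorem SLReach.of_mem (h : t ∈ T) : SLReach A T 0 t := ⟨T, .refl, h⟩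

theorem SLReach.of_gen (h : t ∈ A) : SLReach A T 1 t := ⟨_, .gen .refl h, Set.mem_insert _ _⟩

/-- To reach a product, reach the two factors one after the other. -/
theorem SLReach.mul (ha : SLReach A T m a) (hb : ∀ U, T ⊆ U → SLReach A U n b) :
    SLReach A T (m + n + 1) (a * b) := by
  obtain ⟨U, hU, haU⟩ := ha
  obtain ⟨W, hW, hbW⟩ := hb U hU.subset
  exact ⟨_, (hU.trans hW).mul (hW.subset haU) hbW, Set.mem_insert _ _⟩

theorem slRun_append (P Q : List (SLInstr S)) (r : ℕ → Option S) :
    slRun (P ++ Q) r = (slRun P r).bind (slRun Q) := by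
  induction P generalizing r with
  | nil => rfl
  | cons I P ih =>
    simp only [List.cons_append, slRun]
    cases I.exec r with
    | none => rfl
    | some r' => simp [ih]

theorem SLExtends.exists_program (h : SLExtends A ∅ n U) :
    ∃ P : List (SLInstr S), P.length ≤ n ∧ (∀ I ∈ P, I.IsOver A) ∧
      ∃ r : ℕ → Option S, slRun P (fun _ => none) = some r ∧ (∀ u ∈ U, ∃ k, r k = some u) ∧
        ∀ k, n ≤ k → r k = none := by
  induction h with
  | refl => exact ⟨[], le_rfl, by simp, _, rfl, by simp, by simp⟩
  | skip _ ih =>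
    obtain ⟨P, h1, h2, r, h3, h4, h5⟩ := ih
    exact ⟨P, by omega, h2, r, h3, h4, fun k hk => h5 k (by omega)⟩
  | @gen n U s _ hs ih =>
    obtain ⟨P, h1, h2, r, h3, h4, h5⟩ := ih
    refine ⟨P ++ [.assign n s], by simpa using h1, ?_, Function.update r n (some s), ?_, ?_, ?_⟩
    · intro I hI
      rcases List.mem_append.1 hI with hI | hI
      · exact h2 I hI
      · rw [List.mem_singleton.1 hI]; exact hs
    · simp [slRun_append, h3, slRun, SLInstr.exec]
    · rintro u (rfl | hu)
      · exact ⟨n, by simp⟩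
      · obtain ⟨k, hk⟩ := h4 u hu
        have : k ≠ n := by rintro rfl; simp [h5 k le_rfl] at hk
        exact ⟨k, by simp [this, hk]⟩
    · intro k hk
      simp [show k ≠ n by omega, h5 k (by omega)]
  | @mul n U a b _ ha hb ih =>
    obtain ⟨P, h1, h2, r, h3, h4, h5⟩ := ih
    obtain ⟨i, hi⟩ := h4 a ha
    obtain ⟨j, hj⟩ := h4 b hb
    refine ⟨P ++ [.mul n i j], by simpa using h1, ?_,
      Function.update r n (some (a * b)), ?_, ?_, ?_⟩
    · intro I hI
      rcases List.mem_append.1 hI with hI | hI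
      · exact h2 I hI
      · rw [List.mem_singleton.1 hI]; trivial
    · simp [slRun_append, h3, slRun, SLInstr.exec, hi, hj]
    · rintro u (rfl | hu)
      · exact ⟨n, by simp⟩
      · obtain ⟨k, hk⟩ := h4 u hu
        have : k ≠ n := by rintro rfl; simp [h5 k le_rfl] at hk
        exact ⟨k, by simp [this, hk]⟩
    · intro k hk
      simp [show k ≠ n by omega, h5 k (by omega)]

theorem SLReach.slCost_le (h : SLReach A ∅ n t) : slCost ⊤ A t ≤ n := by
  obtain ⟨U, hU, ht⟩ := h
  obtain ⟨P, h1, h2, r, h3, h4, -⟩ := hU.exists_program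
  refine (iInf₂_le_of_le P ⟨h2, r, h3, h4 t ht⟩ (iInf_le_of_le le_top ?_))
  exact_mod_cast h1

end SLExtends

/-! ### A lower bound: left-regular bands with few short products -/

/-- A program computes only elements generated by the elements that it assigns, and there are at
most as many of these as there are instructions. -/
theorem SLComputes.exists_finset {S : Type} [Mul S] {A : Set S} {P : List (SLInstr S)} {t : S}
    (h : SLComputes A P t) :
    ∃ F : Finset S, F.card ≤ P.length ∧ (F : Set S) ⊆ A ∧ t ∈ Subsemigroup.closure (F : Set S) := by
  classical
  obtain ⟨hA, r, hr, k, hk⟩ := h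
  suffices H : ∀ (P : List (SLInstr S)) (r₀ r : ℕ → Option S) (F₀ : Finset S),
      (∀ I ∈ P, I.IsOver A) → slRun P r₀ = some r → (F₀ : Set S) ⊆ A →
      (∀ k s, r₀ k = some s → s ∈ Subsemigroup.closure (F₀ : Set S)) →
      ∃ F : Finset S, F.card ≤ F₀.card + P.length ∧ (F : Set S) ⊆ A ∧
        ∀ k s, r k = some s → s ∈ Subsemigroup.closure (F : Set S) by
    obtain ⟨F, h1, h2, h3⟩ := H P _ r ∅ hA hr (by simp) (by simp)
    exact ⟨F, by simpa using h1, h2, h3 k t hk⟩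
  intro P
  induction P with
  | nil =>
    intro r₀ r F₀ _ hr hF h
    obtain rfl : r₀ = r := by simpa [slRun] using hr
    exact ⟨F₀, by simp, hF, h⟩
  | cons I P ih =>
    intro r₀ r F₀ hA hr hF h
    have hA' : ∀ I ∈ P, I.IsOver A := fun J hJ => hA J (List.mem_cons_of_mem _ hJ)
    rw [slRun, Option.bind_eq_some_iff] at hr
    obtain ⟨r₁, h1, hr⟩ := hr
    cases I with
    | assign j s =>
      obtain rfl := Option.some.inj h1
      have hs : s ∈ A := hA (.assign j s) List.mem_cons_self
      obtain ⟨F, hF1, hF2, hF3⟩ := ih _ r (insert s F₀) hA' hr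
        (by simpa [Set.insert_subset_iff] using ⟨hs, hF⟩) (by
          intro k u hu
          by_cases hkj : k = j
          · subst hkj
            obtain rfl : s = u := by simpa using hu
            exact Subsemigroup.subset_closure (by simp)
          · exact Subsemigroup.closure_mono (by simp) (h k u (by simpa [hkj] using hu)))
      refine ⟨F, ?_, hF2, hF3⟩
      have := Finset.card_insert_le s F₀
      simp only [List.length_cons]
      omega
    | mul j i i' =>
      simp only [SLInstr.exec, Option.bind_eq_some_iff, Option.some.injEq] at h1
      obtain ⟨a, ha, b, hb, rfl⟩ := h1
      obtain ⟨F, hF1, hF2, hF3⟩ := ih _ r F₀ hA' hr hF (by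
          intro k u hu
          by_cases hkj : k = j
          · subst hkj
            obtain rfl : a * b = u := by simpa using hu
            exact mul_mem (h _ _ ha) (h _ _ hb)
          · exact h k u (by simpa [hkj] using hu))
      refine ⟨F, ?_, hF2, hF3⟩
      simp only [List.length_cons]
      omega

theorem le_slCost_of_forall_finset {S : Type} [Mul S] {A : Set S} {t : S} {n : ℕ} (w : ℕ∞)
    (h : ∀ F : Finset S, (F : Set S) ⊆ A → t ∈ Subsemigroup.closure (F : Set S) → n ≤ F.card) :
    (n : ℕ∞) ≤ slCost w A t := by
  refine le_iInf fun P => le_iInf fun hP => le_iInf fun _ => ?_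
  obtain ⟨F, h1, h2, h3⟩ := hP.exists_finset
  exact_mod_cast (h F h2 h3).trans h1

/-- The intervals `(i, m]` with `0 ≤ i ≤ m ≤ n`, encoded by their end points. The interval `(i, m]`
acts from the right on the chain `0 < ⋯ < n` as the partial map `x ↦ max x m` with domain
`{x | i ≤ x}`, and the product below is the composition of these maps. -/
def IntervalBand (n : ℕ) : Type := {p : ℕ × ℕ // p.1 ≤ p.2 ∧ p.2 ≤ n}

namespace IntervalBand

variable {n : ℕ}

theorem ext {a b : IntervalBand n} (h1 : a.1.1 = b.1.1) (h2 : a.1.2 = b.1.2) : a = b :=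
  Subtype.ext (Prod.ext h1 h2)

instance : Mul (IntervalBand n) where
  mul a b := ⟨(if b.1.1 ≤ a.1.2 then a.1.1 else b.1.1, max a.1.2 b.1.2), by
    have := a.2; have := b.2
    dsimp only
    split_ifs <;> omega⟩

theorem fst_mul (a b : IntervalBand n) :
    (a * b).1.1 = if b.1.1 ≤ a.1.2 then a.1.1 else b.1.1 := rfl

theorem snd_mul (a b : IntervalBand n) : (a * b).1.2 = max a.1.2 b.1.2 := rfl

instance : Semigroup (IntervalBand n) where
  mul_assoc a b c := by
    have := a.2; have := b.2; have := c.2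
    apply ext
    · simp only [fst_mul, snd_mul]
      split_ifs <;> omega
    · simp only [snd_mul]
      omega

theorem mul_self (a : IntervalBand n) : a * a = a := by
  have := a.2
  apply ext
  · simp [fst_mul]
  · simp [snd_mul]

theorem mul_mul_self (a b : IntervalBand n) : a * b * a = a * b := by
  have := a.2; have := b.2
  apply ext
  · simp only [fst_mul, snd_mul]
    split_ifs <;> omega
  · simp only [snd_mul]
    omega

theorem finite_and_card_le : Finite (IntervalBand n) ∧ Nat.card (IntervalBand n) ≤ (n + 1) ^ 2 := by
  let f : IntervalBand n → Fin (n + 1) × Fin (n + 1) := fun a =>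
    (⟨a.1.1, by have := a.2; omega⟩, ⟨a.1.2, by have := a.2; omega⟩)
  have hf : Function.Injective f := by
    intro a b hab
    simp only [f, Prod.mk.injEq, Fin.mk.injEq] at hab
    exact ext hab.1 hab.2
  refine ⟨Finite.of_injective f hf, ?_⟩
  simpa [sq] using Nat.card_le_card_of_injective f hf

instance : Finite (IntervalBand n) := finite_and_card_le.1

/-- The interval `(j, j + 1]`. -/
def unit (j : Fin n) : IntervalBand n := ⟨(j, j + 1), by simp, j.2⟩

theorem unit_injective : Function.Injective (unit (n := n)) := fun _ _ h =>
  Fin.ext (congrArg (fun a => a.1.1) h)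

/-- The interval `(0, k]`. -/
def initial (k : ℕ) (hk : k ≤ n) : IntervalBand n := ⟨(0, k), Nat.zero_le _, hk⟩

theorem initial_succ (k : ℕ) (hk : k + 1 ≤ n) :
    initial (k + 1) hk = initial k (by omega) * unit ⟨k, hk⟩ := by
  apply ext
  · rw [fst_mul]; simp [initial, unit]
  · rw [snd_mul]; simp [initial, unit]

/-- Each point of a product of intervals is a point of one of the factors. -/
theorem covered_mul {J : Set ℕ} {a b : IntervalBand n}
    (ha : ∀ j, a.1.1 ≤ j → j < a.1.2 → j ∈ J) (hb : ∀ j, b.1.1 ≤ j → j < b.1.2 → j ∈ J) :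
    ∀ j, (a * b).1.1 ≤ j → j < (a * b).1.2 → j ∈ J := by
  have := a.2; have := b.2
  intro j h1 h2
  rw [fst_mul] at h1
  rw [snd_mul] at h2
  split_ifs at h1
  · by_cases h : j < a.1.2
    · exact ha j h1 h
    · exact hb j (by omega) (by omega)
  · exact hb j h1 (by omega)

/-- If the intervals `(j, j + 1]` that are represented in `F` by `g` cover `(0, n]`, then `F` has
at least `n` elements. -/
theorem le_card_of_covered {α : Type} (g : Fin n → α) (hg : Function.Injective g) (F : Finset α)
    (h : ∀ j < n, j ∈ {j | ∃ h : j < n, g ⟨j, h⟩ ∈ F}) : n ≤ F.card := by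
  have h2 : (Finset.univ.map ⟨g, hg⟩) ⊆ F := by
    intro x hx
    obtain ⟨j, -, rfl⟩ := Finset.mem_map.1 hx
    obtain ⟨_, h⟩ := h j j.2
    exact h
  simpa using Finset.card_le_card h2

theorem le_slCostMax (w : ℕ∞) (hn : 1 ≤ n) : (n : ℕ∞) ≤ slCostMax w (IntervalBand n) := by
  have ht : initial n le_rfl ∈ Subsemigroup.closure (Set.range (unit (n := n))) := by
    suffices ∀ k (hk : k + 1 ≤ n),
        initial (k + 1) hk ∈ Subsemigroup.closure (Set.range (unit (n := n))) by
      obtain ⟨k, rfl⟩ : ∃ k, n = k + 1 := ⟨n - 1, by omega⟩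
      exact this k le_rfl
    intro k
    induction k with
    | zero => exact fun hk => Subsemigroup.subset_closure ⟨⟨0, hk⟩, rfl⟩
    | succ k ih =>
      intro hk
      rw [initial_succ]
      exact mul_mem (ih _) (Subsemigroup.subset_closure ⟨_, rfl⟩)
  refine le_iSup_of_le _ (le_iSup_of_le _ (le_iSup_of_le ht ?_))
  refine le_slCost_of_forall_finset w fun F hF htF => le_card_of_covered unit unit_injective F ?_
  suffices ∀ a ∈ Subsemigroup.closure (F : Set (IntervalBand n)), ∀ j, a.1.1 ≤ j → j < a.1.2 →
      j ∈ {j | ∃ h : j < n, unit ⟨j, h⟩ ∈ F} from fun j hj => this _ htF j (Nat.zero_le _) hj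
  intro a ha
  induction ha using Subsemigroup.closure_induction with
  | mem a ha =>
    obtain ⟨i, rfl⟩ := hF ha
    intro j h1 h2
    obtain rfl : (i : ℕ) = j := by simp only [unit] at h1 h2; omega
    exact ⟨i.2, ha⟩
  | mul a b _ _ iha ihb => exact covered_mul iha ihb

open MulOpposite in
theorem le_slCostMax_op (w : ℕ∞) (hn : 1 ≤ n) : (n : ℕ∞) ≤ slCostMax w (IntervalBand n)ᵐᵒᵖ := by
  have ht : op (initial n le_rfl) ∈
      Subsemigroup.closure (Set.range fun j : Fin n => op (unit j)) := by
    suffices ∀ k (hk : k + 1 ≤ n),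
        op (initial (k + 1) hk) ∈ Subsemigroup.closure (Set.range fun j : Fin n => op (unit j)) by
      obtain ⟨k, rfl⟩ : ∃ k, n = k + 1 := ⟨n - 1, by omega⟩
      exact this k le_rfl
    intro k
    induction k with
    | zero => exact fun hk => Subsemigroup.subset_closure ⟨⟨0, hk⟩, rfl⟩
    | succ k ih =>
      intro hk
      rw [initial_succ, op_mul]
      exact mul_mem (Subsemigroup.subset_closure ⟨_, rfl⟩) (ih _)
  refine le_iSup_of_le _ (le_iSup_of_le _ (le_iSup_of_le ht ?_))
  refine le_slCost_of_forall_finset w fun F hF htF =>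
    le_card_of_covered (fun j => op (unit j)) (op_injective.comp unit_injective) F ?_
  suffices ∀ a ∈ Subsemigroup.closure (F : Set (IntervalBand n)ᵐᵒᵖ),
      ∀ j, a.unop.1.1 ≤ j → j < a.unop.1.2 →
      j ∈ {j | ∃ h : j < n, op (unit ⟨j, h⟩) ∈ F} from fun j hj => this _ htF j (Nat.zero_le _) hj
  intro a ha
  induction ha using Subsemigroup.closure_induction with
  | mem a ha =>
    obtain ⟨i, rfl⟩ := hF ha
    intro j h1 h2
    obtain rfl : (i : ℕ) = j := by
      replace h1 : (i : ℕ) ≤ j := h1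
      replace h2 : j < i + 1 := h2
      omega
    exact ⟨i.2, ha⟩
  | mul a b _ _ iha ihb => exact covered_mul ihb iha

theorem lrb : LRB (IntervalBand n) :=
  ⟨inferInstance, ⟨initial 0 (Nat.zero_le _)⟩, mul_self, mul_mul_self⟩

theorem rrb_op : RRB (IntervalBand n)ᵐᵒᵖ :=
  ⟨Finite.of_equiv _ MulOpposite.opEquiv, ⟨.op (initial 0 (Nat.zero_le _))⟩,
    fun a => congrArg MulOpposite.op (mul_self a.unop),
    fun a b => congrArg MulOpposite.op (by
      simpa [mul_assoc] using mul_mul_self a.unop b.unop)⟩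

end IntervalBand

/-- Members of size at most `(n + 1) ^ 2` and cost at least `n`, for all `n ≥ 1`, rule out efficient
compression. -/
theorem not_efficientCompression {V : SemigroupClass} (S : ℕ → Type) [∀ n, Semigroup (S n)]
    (hS : ∀ n, V (S n)) (hcard : ∀ n, Nat.card (S n) ≤ (n + 1) ^ 2)
    (hcost : ∀ n : ℕ, 1 ≤ n → (n : ℕ∞) ≤ slCostMax ⊤ (S n)) : ¬ V.EfficientCompression := by
  rintro ⟨k, K, hK⟩
  have h1 : Filter.Tendsto (fun n : ℕ => (n + 1) ^ 2) Filter.atTop Filter.atTop :=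
    (Filter.tendsto_pow_atTop two_ne_zero).comp (Filter.tendsto_add_atTop_nat 1)
  have h2 := h1.eventually hK
  have h3 : (fun x : ℝ => Real.log x ^ k) =o[Filter.atTop] fun x => x :=
    Real.isLittleO_pow_log_id_atTop
  have h4 : Filter.Tendsto (fun n : ℕ => ((n : ℝ) + 1)) Filter.atTop Filter.atTop :=
    Filter.tendsto_atTop_add_const_right _ _ tendsto_natCast_atTop_atTop
  have h5 := h4.eventually (h3.bound (c := 1 / (4 * (|K| * 2 ^ k + 1))) (by positivity))
  obtain ⟨n, h2, h5, hn⟩ := (h2.and (h5.and (Filter.eventually_ge_atTop 2))).exists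
  have hlow : (n : ℕ∞) ≤ V.slCost ⊤ ((n + 1) ^ 2) :=
    (hcost n (by omega)).trans <| le_iSup_of_le (S n) <| le_iSup_of_le inferInstance <|
      le_iSup_of_le (hS n) <| le_iSup_of_le (hcard n) le_rfl
  have h6 : (n : ℝ≥0∞) ≤ ENNReal.ofReal (K * |Real.log ((n + 1) ^ 2 : ℕ) ^ k|) := by
    refine le_trans ?_ h2
    exact_mod_cast hlow
  rw [← ENNReal.ofReal_natCast] at h6
  have hn' : (2 : ℝ) ≤ n := by exact_mod_cast hn
  have h7 : (n : ℝ) ≤ K * |Real.log ((n + 1) ^ 2 : ℕ) ^ k| := by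
    by_contra hlt
    push Not at hlt
    exact absurd h6 (not_le.2 ((ENNReal.ofReal_lt_ofReal_iff (by linarith)).2 hlt))
  rw [Real.norm_eq_abs, Real.norm_eq_abs, abs_of_pos (a := (n : ℝ) + 1) (by linarith)] at h5
  have h8 : |Real.log ((n + 1) ^ 2 : ℕ) ^ k| = 2 ^ k * |Real.log ((n : ℝ) + 1) ^ k| := by
    push_cast
    rw [Real.log_pow, mul_pow, abs_mul]
    simp
  rw [h8] at h7
  have h9 : K * (2 ^ k * |Real.log ((n : ℝ) + 1) ^ k|)
      ≤ (|K| * 2 ^ k + 1) * |Real.log ((n : ℝ) + 1) ^ k| := by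
    nlinarith [mul_le_mul_of_nonneg_right (le_abs_self K)
      (show 0 ≤ 2 ^ k * |Real.log ((n : ℝ) + 1) ^ k| by positivity),
      abs_nonneg (Real.log ((n : ℝ) + 1) ^ k)]
  have h10 : (|K| * 2 ^ k + 1) * |Real.log ((n : ℝ) + 1) ^ k| ≤ ((n : ℝ) + 1) / 4 := by
    refine (mul_le_mul_of_nonneg_left h5 (by positivity)).trans (le_of_eq ?_)
    field_simp
  linarith

theorem not_contained_of_efficientCompression {V : SemigroupClass} (h : V.EfficientCompression) :
    ¬ LRB.Contained V ∧ ¬ RRB.Contained V := by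
  refine ⟨fun hV => ?_, fun hV => ?_⟩
  · exact not_efficientCompression IntervalBand (fun n => hV _ IntervalBand.lrb)
      (fun n => IntervalBand.finite_and_card_le.2) (fun n => IntervalBand.le_slCostMax ⊤) h
  · refine not_efficientCompression (fun n => (IntervalBand n)ᵐᵒᵖ)
      (fun n => hV _ IntervalBand.rrb_op) (fun n => ?_)
      (fun n => IntervalBand.le_slCostMax_op ⊤) h
    rw [← Nat.card_congr MulOpposite.opEquiv]
    exact IntervalBand.finite_and_card_le.2

/-! ### Divisors and duals -/

/-- A pseudovariety contains the divisors of its members. The divisor is given here as a common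
homomorphic source `F` of a subsemigroup of `P` and of `S`. -/
theorem IsPseudovariety.of_divides {V : SemigroupClass} (hV : IsPseudovariety V)
    {P F S : Type} [Semigroup P] [Semigroup F] [Semigroup S] [Nonempty F] (hP : V P) (p : F →ₙ* P)
    (q : F →ₙ* S) (hq : Function.Surjective q) (hpq : ∀ u v, p u = p v → q u = q v) : V S := by
  let r : p.srange →ₙ* S :=
    { toFun := fun x => q x.2.choose
      map_mul' := fun x y => by
        rw [← map_mul]
        refine hpq _ _ ?_
        rw [(x * y).2.choose_spec, map_mul, x.2.choose_spec, y.2.choose_spec]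
        rfl }
  refine hV.image _ _ r (fun s => ?_) (hV.subsemigroup P hP p.srange ?_)
  · obtain ⟨u, rfl⟩ := hq s
    exact ⟨⟨p u, u, rfl⟩, hpq _ _ (Exists.choose_spec (p := fun v => p v = p u) ⟨u, rfl⟩)⟩
  · exact ⟨_, Classical.arbitrary F, rfl⟩

theorem IsPseudovariety.of_injective {V : SemigroupClass} (hV : IsPseudovariety V)
    {P S : Type} [Semigroup P] [Semigroup S] [Nonempty S] (hP : V P) (f : S →ₙ* P)
    (hf : Function.Injective f) : V S :=
  hV.of_divides hP f (MulHom.id S) Function.surjective_id fun _ _ h => hf h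

/-- The class of the semigroups whose opposite belongs to `V`. -/
def SemigroupClass.dual (V : SemigroupClass) : SemigroupClass := fun S _ => V Sᵐᵒᵖ

open MulOpposite in
theorem IsPseudovariety.dual {V : SemigroupClass} (hV : IsPseudovariety V) :
    IsPseudovariety V.dual where
  finite S _ h := by
    have := hV.finite _ h
    exact Finite.of_equiv _ opEquiv.symm
  nonempty S _ h := (hV.nonempty _ h).map unop
  pi ι _ S _ h := by
    refine hV.image _ _ ({ toFun := fun x => op fun i => unop (x i), map_mul' := fun _ _ => rfl } :
      (∀ i, (S i)ᵐᵒᵖ) →ₙ* (∀ i, S i)ᵐᵒᵖ) (fun x => ?_) (hV.pi ι _ h)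
    exact ⟨fun i => op (unop x i), rfl⟩
  subsemigroup S _ h T hT := by
    have : Nonempty (T)ᵐᵒᵖ := hT.to_subtype.map MulOpposite.op
    refine hV.of_injective h ({ toFun := fun x => op (unop x).1, map_mul' := fun _ _ => rfl } :
      (T)ᵐᵒᵖ →ₙ* Sᵐᵒᵖ) fun x y hxy => ?_
    exact unop_injective (Subtype.ext (op_injective hxy))
  image S T _ _ f hf h := by
    refine hV.image _ _ ({ toFun := fun x => op (f (unop x)), map_mul' := fun x y => ?_ } :
      Sᵐᵒᵖ →ₙ* Tᵐᵒᵖ) (fun x => ?_) h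
    · rw [unop_mul, map_mul, op_mul]
    · obtain ⟨s, hs⟩ := hf (unop x)
      exact ⟨MulOpposite.op s, by simp [hs]⟩

open MulOpposite in
theorem rrb_contained_of_lrb_contained_dual {V : SemigroupClass} (hV : IsPseudovariety V)
    (h : LRB.Contained V.dual) : RRB.Contained V := by
  rintro S _ ⟨hfin, hne, h1, h2⟩
  have hS : LRB Sᵐᵒᵖ := ⟨Finite.of_equiv _ opEquiv, hne.map MulOpposite.op,
    fun x => unop_injective (h1 _), fun x y => unop_injective (by
      simpa [mul_assoc] using h2 x.unop y.unop)⟩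
  refine hV.image _ _ ({ toFun := fun x => unop (unop x), map_mul' := fun _ _ => rfl } :
    Sᵐᵒᵖᵐᵒᵖ →ₙ* S) (fun x => ?_) (h _ hS)
  exact ⟨MulOpposite.op (MulOpposite.op x), rfl⟩

/-! ### The left-regular bands are generated by the three-element one -/

/-- The two-element left-zero semigroup `{zero, zero'}` with an identity adjoined. -/
inductive LeftZeroOne : Type
  | one
  | zero
  | zero'

namespace LeftZeroOne

instance : Monoid LeftZeroOne where
  one := one
  mul
    | one, y => y
    | zero, _ => zero
    | zero', _ => zero'
  mul_assoc x y z := by cases x <;> rfl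
  one_mul _ := rfl
  mul_one x := by cases x <;> rfl

theorem one_eq : (one : LeftZeroOne) = 1 := rfl

theorem zero_mul (x : LeftZeroOne) : zero * x = zero := rfl

theorem zero'_mul (x : LeftZeroOne) : zero' * x = zero' := rfl

end LeftZeroOne

section Words

variable {α L : Type} [Monoid L]

/-- In a left-regular band, the letter `x` may be dropped after a prefix that absorbs `g x`. -/
theorem mul_prod_filter_ne [DecidableEq α] (hL : ∀ x y : L, x * y * x = x * y) (g : α → L)
    (x : α) (l : List α) (p : L) (hp : p * g x = p) :
    p * (l.map g).prod = p * ((l.filter (· ≠ x)).map g).prod := by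
  induction l generalizing p with
  | nil => rfl
  | cons y l ih =>
    by_cases hyx : y = x
    · subst hyx
      rw [List.filter_cons_of_neg (by simp), ← ih p hp, List.map_cons, List.prod_cons,
        ← mul_assoc, hp]
    · rw [List.filter_cons_of_pos (by simpa using hyx)]
      simp only [List.map_cons, List.prod_cons, ← mul_assoc]
      refine ih _ ?_
      rw [← hp, mul_assoc, mul_assoc, ← mul_assoc (g x), hL, ← mul_assoc, hp]

/-- Words that agree under all substitutions into `LeftZeroOne` have the same letters in the same
order of first occurrence, so they agree in all left-regular bands. -/
theorem prod_eq_of_forall_leftZeroOne (hL : ∀ x y : L, x * y * x = x * y) (g : α → L) :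
    ∀ u v : List α, (∀ f : α → LeftZeroOne, (u.map f).prod = (v.map f).prod) →
      (u.map g).prod = (v.map g).prod := by
  classical
  intro u
  induction hn : u.length using Nat.strong_induction_on generalizing u with
  | _ n ih =>
    intro v huv
    match u, v with
    | [], [] => rfl
    | [], y :: v =>
      have := huv fun _ => .zero
      simp [LeftZeroOne.zero_mul, ← LeftZeroOne.one_eq] at this
    | x :: u, [] =>
      have := huv fun _ => .zero
      simp [LeftZeroOne.zero_mul, ← LeftZeroOne.one_eq] at this
    | x :: u, y :: v =>
      have hxy : x = y := by
        by_contra hxy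
        have := huv fun z => if z = x then .zero else .zero'
        simp [LeftZeroOne.zero_mul, LeftZeroOne.zero'_mul, Ne.symm hxy] at this
      subst hxy
      have hgx : g x * g x = g x := by simpa using hL (g x) 1
      simp only [List.map_cons, List.prod_cons]
      rw [mul_prod_filter_ne hL g x u _ hgx, mul_prod_filter_ne hL g x v _ hgx]
      congr 1
      refine ih _ ?_ _ rfl _ fun f => ?_
      · have := List.length_filter_le (fun z => decide (z ≠ x)) u
        simp only [List.length_cons] at hn
        omega
      · -- Substituting `1` for `x` deletes the letter `x`.
        have key : ∀ l : List α, ((l.filter (· ≠ x)).map f).prod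
            = (l.map (Function.update f x 1)).prod := by
          intro l
          induction l with
          | nil => rfl
          | cons z l ihl =>
            by_cases hz : z = x
            · subst hz
              simpa using ihl
            · rw [List.filter_cons_of_pos (by simpa using hz), List.map_cons, List.map_cons,
                List.prod_cons, List.prod_cons, ihl, Function.update_of_ne hz]
        rw [key, key]
        simpa using huv (Function.update f x 1)

end Words

theorem FreeSemigroup.lift_eq_prod {α L : Type} [Monoid L] (f : α → L) (w : FreeSemigroup α) :
    FreeSemigroup.lift f w = ((w.head :: w.tail).map f).prod := by
  induction w using FreeSemigroup.recOnMul with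
  | ih1 x => simp
  | ih2 x y h1 h2 =>
    simp only [map_mul, h1, h2, FreeSemigroup.head_mul, FreeSemigroup.tail_mul]
    simp

theorem lrb_contained_of_leftZeroOne {V : SemigroupClass} (hV : IsPseudovariety V)
    (h : V LeftZeroOne) : LRB.Contained V := by
  rintro S _ ⟨hfin, hne, h1, h2⟩
  have : Finite LeftZeroOne := hV.finite _ h
  have hlrb : ∀ x y : WithOne S, x * y * x = x * y := by
    intro x y
    cases x with
    | one => simp
    | coe x =>
      cases y with
      | one => simp [← WithOne.coe_mul, h1]
      | coe y => simp [← WithOne.coe_mul, h2]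
  refine hV.of_divides (hV.pi (S → LeftZeroOne) (fun _ => LeftZeroOne) fun _ => h)
    (FreeSemigroup.lift fun s f => f s) (FreeSemigroup.lift (fun s : S => s))
    (fun s => ⟨FreeSemigroup.of s, by simp⟩) fun u v huv => ?_
  have hcoe : ∀ w : FreeSemigroup S, ((FreeSemigroup.lift (fun s : S => s) w : S) : WithOne S)
      = FreeSemigroup.lift (fun s : S => (s : WithOne S)) w := by
    intro w
    induction w using FreeSemigroup.recOnMul with
    | ih1 x => simp
    | ih2 x y _ hy => simp [hy]
  have heval : ∀ (f : S → LeftZeroOne) (w : FreeSemigroup S),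
      (FreeSemigroup.lift (fun s (f : S → LeftZeroOne) => f s) w) f = FreeSemigroup.lift f w := by
    intro f w
    induction w using FreeSemigroup.recOnMul with
    | ih1 x => simp
    | ih2 x y _ hy => simp [hy]
  refine WithOne.coe_injective ?_
  rw [hcoe, hcoe, FreeSemigroup.lift_eq_prod, FreeSemigroup.lift_eq_prod]
  refine prod_eq_of_forall_leftZeroOne hlrb _ _ _ fun f => ?_
  rw [← FreeSemigroup.lift_eq_prod, ← FreeSemigroup.lift_eq_prod, ← heval, ← heval, huv]

/-- The left-zero pairs below an idempotent of `S` are trivial. -/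
def LeftRigid (S : Type) [Mul S] : Prop :=
  ∀ e f g : S, e * e = e → e * f = f → f * e = f → e * g = g → g * e = g →
    f * g = f → g * f = g → f = g

/-- A nontrivial left-zero pair below an idempotent spans a copy of `LeftZeroOne`. -/
theorem leftRigid_of_not_lrb_contained {V : SemigroupClass} (hV : IsPseudovariety V)
    (h : ¬ LRB.Contained V) {S : Type} [Semigroup S] (hS : V S) : LeftRigid S := by
  intro e f g hee hef hfe heg hge hfg hgf
  by_contra hne
  have hff : f * f = f := by
    calc f * f = f * g * f := by rw [hfg]
      _ = f := by rw [mul_assoc, hgf, hfg]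
  have hgg : g * g = g := by
    calc g * g = g * f * g := by rw [hgf]
      _ = g := by rw [mul_assoc, hfg, hgf]
  have hf : e ≠ f := by rintro rfl; exact hne (hfg.symm.trans heg)
  have hg : e ≠ g := by rintro rfl; exact hne (hef.symm.trans hgf)
  refine h (lrb_contained_of_leftZeroOne hV ?_)
  have : Nonempty LeftZeroOne := ⟨1⟩
  refine hV.of_injective hS
    ({ toFun := fun x => match x with
        | .one => e
        | .zero => f
        | .zero' => g
       map_mul' := ?_ } : LeftZeroOne →ₙ* S) ?_
  · rintro (_ | _ | _) (_ | _ | _)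
    exacts [hee.symm, hef.symm, heg.symm, hfe.symm, hff.symm, hfg.symm, hge.symm, hgf.symm,
      hgg.symm]
  · rintro (_ | _ | _) (_ | _ | _) hxy
    exacts [rfl, (hf hxy).elim, (hg hxy).elim, (hf hxy.symm).elim, rfl, (hne hxy).elim,
      (hg hxy.symm).elim, (hne hxy.symm).elim, rfl]

/-! ### Rigid completely regular semigroups are normal bands of groups -/

/-- A completely regular semigroup, with `i x` the inverse of `x` in a subgroup that contains `x`,
in which all left-zero pairs and all right-zero pairs below an idempotent are trivial. -/
structure IsRigidCR {S : Type} [Semigroup S] (i : S → S) : Prop where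
  comm : ∀ x, x * i x = i x * x
  mul_inv_mul : ∀ x, x * i x * x = x
  inv_mul_inv : ∀ x, i x * x * i x = i x
  left : LeftRigid S
  right : LeftRigid Sᵐᵒᵖ

namespace IsRigidCR

variable {S : Type} [Semigroup S] {i : S → S} (h : IsRigidCR i)
include h

open MulOpposite in
theorem dual : IsRigidCR fun x : Sᵐᵒᵖ => MulOpposite.op (i x.unop) where
  comm x := unop_injective (h.comm _).symm
  mul_inv_mul x := unop_injective (by simpa [mul_assoc] using h.mul_inv_mul x.unop)
  inv_mul_inv x := unop_injective (by simpa [mul_assoc] using h.inv_mul_inv x.unop)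
  left := h.right
  right := fun e f g h1 h2 h3 h4 h5 h6 h7 => unop_injective (unop_injective
    (h.left e.unop.unop f.unop.unop g.unop.unop
      (op_injective (op_injective h1)) (op_injective (op_injective h2))
      (op_injective (op_injective h3)) (op_injective (op_injective h4))
      (op_injective (op_injective h5)) (op_injective (op_injective h6))
      (op_injective (op_injective h7))))

theorem mul_self_mul_inv (x : S) : x * (x * i x) = x := by
  rw [h.comm, ← mul_assoc, h.mul_inv_mul]

theorem idem (x : S) : x * i x * (x * i x) = x * i x := by
  rw [← mul_assoc, h.mul_inv_mul]

/-- The identities of the maximal subgroups around `x` and `y` agree as soon as the first is a left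
identity for `y` and the second is a right identity for `x`. -/
theorem one_eq_one {x y : S} (h1 : x * (y * i y) = x) (h2 : x * i x * y = y) :
    x * i x = y * i y := by
  calc x * i x = i x * (x * (y * i y)) := by rw [h1, h.comm]
    _ = x * i x * y * i y := by rw [← mul_assoc, ← h.comm, mul_assoc _ y]
    _ = y * i y := by rw [h2]

theorem right_eq {e f g : S} (hee : e * e = e) (hef : e * f = f) (hfe : f * e = f)
    (heg : e * g = g) (hge : g * e = g) (hgf : g * f = f) (hfg : f * g = g) : f = g :=
  MulOpposite.op_injective (h.right (.op e) (.op f) (.op g) (congrArg _ hee) (congrArg _ hfe)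
    (congrArg _ hef) (congrArg _ hge) (congrArg _ heg) (congrArg _ hgf) (congrArg _ hfg))

/-- The idempotents `p` and `p * f`, where `p` is the identity of the subgroup around `f * g`, form
a right-zero pair. -/
theorem idem_mul_idem_mul {e f g : S} (hee : e * e = e) (hef : e * f = f) (hfe : f * e = f)
    (hge : g * e = g) (hff : f * f = f) : f * g * f = f * g := by
  obtain ⟨p, hp⟩ : ∃ p, p = f * g * i (f * g) := ⟨_, rfl⟩
  have hpp : p * p = p := by rw [hp, h.idem]
  have hfp : f * p = p := by rw [hp, ← mul_assoc, ← mul_assoc, hff]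
  have hep : e * p = p := by rw [← hfp, ← mul_assoc, hef]
  have hpe : p * e = p := by rw [hp, h.comm, mul_assoc, mul_assoc, hge]
  have hfgp : f * g * p = f * g := by rw [hp, h.mul_self_mul_inv]
  have : p = p * f := h.right_eq hee hep hpe (by rw [← mul_assoc, hep]) (by rw [mul_assoc, hfe])
    (by rw [mul_assoc, hfp, hpp]) (by rw [← mul_assoc, hpp])
  calc f * g * f = f * g * p * f := by rw [hfgp]
    _ = f * g := by rw [mul_assoc, ← this, hfgp]

theorem idem_comm {e f g : S} (hee : e * e = e) (hef : e * f = f) (hfe : f * e = f)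
    (heg : e * g = g) (hge : g * e = g) (hff : f * f = f) : f * g = g * f := by
  rw [← h.idem_mul_idem_mul hee hef hfe hge hff, mul_assoc]
  exact congrArg MulOpposite.unop (h.dual.idem_mul_idem_mul (e := .op e) (f := .op f)
    (g := .op g) (congrArg _ hee) (congrArg _ hfe) (congrArg _ hef) (congrArg _ heg)
    (congrArg _ hff))

/-- In a local submonoid `eSe`, idempotents are central. -/
theorem central {e f x : S} (hee : e * e = e) (hef : e * f = f) (hfe : f * e = f)
    (hex : e * x = x) (hxe : x * e = x) (hff : f * f = f) : x * f = f * x := by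
  have h1 : f * (x * f) = x * f := by
    obtain ⟨k, hk⟩ : ∃ k, k = x * f * i (x * f) := ⟨_, rfl⟩
    have hek : e * k = k := by rw [hk, ← mul_assoc, ← mul_assoc, hex]
    have hkf : k * f = k := by rw [hk, h.comm, mul_assoc, mul_assoc, hff]
    have hke : k * e = k := by rw [← hkf, mul_assoc, hfe]
    have hfk : f * k = k := by rw [h.idem_comm hee hef hfe hek hke hff, hkf]
    have hkx : k * (x * f) = x * f := by rw [hk, h.mul_inv_mul]
    rw [← hkx, ← mul_assoc, hfk]
  have h2 : f * x * f = f * x := by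
    obtain ⟨k, hk⟩ : ∃ k, k = f * x * i (f * x) := ⟨_, rfl⟩
    have hke : k * e = k := by rw [hk, h.comm, mul_assoc, mul_assoc, hxe]
    have hfk : f * k = k := by rw [hk, ← mul_assoc, ← mul_assoc, hff]
    have hek : e * k = k := by rw [← hfk, ← mul_assoc, hef]
    have hkf : k * f = k := by rw [← h.idem_comm hee hef hfe hek hke hff, hfk]
    have hkx : f * x * k = f * x := by rw [hk, h.mul_self_mul_inv]
    rw [← hkx, mul_assoc, hkf]
  rw [← h1, ← mul_assoc, h2]

/-- Replacing the left factor by the identity `e` of its subgroup does not change the subgroup of a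
product. Both `x * b` and `e * b` are compared with their images under right multiplication by `e`,
which lie in the local submonoid `eSe`, where idempotents are central. -/
theorem one_mul_left (x b : S) :
    x * b * i (x * b) = x * i x * b * i (x * i x * b) := by
  obtain ⟨e, he⟩ : ∃ e, e = x * i x := ⟨_, rfl⟩
  have hee : e * e = e := by rw [he, h.idem]
  have hex : e * x = x := by rw [he, h.mul_inv_mul]
  have hxe : x * e = x := by rw [he, h.mul_self_mul_inv]
  have hix : i x * x = e := by rw [he, h.comm]
  have hei : e * i x = i x := by rw [← hix, h.inv_mul_inv]
  have hie : i x * e = i x := by rw [he, ← mul_assoc, h.inv_mul_inv]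
  rw [← he]
  obtain ⟨k, hk⟩ : ∃ k, k = x * b * e * i (x * b * e) := ⟨_, rfl⟩
  have hkk : k * k = k := by rw [hk, h.idem]
  have hek : e * k = k := by rw [hk]; simp only [← mul_assoc, hex]
  have hke : k * e = k := by rw [hk, h.comm]; simp only [mul_assoc, hee]
  have hk1 : k * (x * b * e) = x * b * e := by rw [hk, h.mul_inv_mul]
  have hk2 : k * (e * b * e) = e * b * e := by
    calc k * (e * b * e) = k * i x * (x * b * e) := by rw [← hix]; simp only [mul_assoc]
      _ = i x * (k * (x * b * e)) := by
        rw [← h.central hee hek hke hei hie hkk, mul_assoc]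
      _ = e * b * e := by rw [hk1, ← hix]; simp only [mul_assoc]
  refine h.one_eq_one ?_ ?_
  · calc x * b * (e * b * i (e * b)) = x * (e * b * (e * b * i (e * b))) := by
          simp only [← mul_assoc, hxe]
      _ = x * b := by rw [h.mul_self_mul_inv, ← mul_assoc, hxe]
  · have hk3 : k * (e * b) = e * b := by
      have heb : e * b * e * (b * i (e * b)) = e * b := by
        simpa only [mul_assoc] using h.mul_self_mul_inv (e * b)
      rw [← heb, ← mul_assoc, hk2]
    have hk4 : x * b * i (x * b) * k = k := by
      calc x * b * i (x * b) * k
          = x * b * i (x * b) * (x * b) * (e * i (x * b * e)) := by rw [hk]; simp only [mul_assoc]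
        _ = k := by rw [h.mul_inv_mul, hk]; simp only [mul_assoc]
    rw [← hk3, ← mul_assoc, hk4]

theorem one_mul_right (b x : S) :
    b * x * i (b * x) = b * (x * i x) * i (b * (x * i x)) := by
  have := congrArg MulOpposite.unop (h.dual.one_mul_left (.op x) (.op b))
  simp only [← MulOpposite.op_mul, MulOpposite.unop_op] at this
  rwa [← h.comm, ← h.comm, ← h.comm] at this

/-- The subgroup of a product depends only on the subgroups of the factors. -/
theorem one_mul_congr {x x' y y' : S} (hx : x * i x = x' * i x') (hy : y * i y = y' * i y') :
    x * y * i (x * y) = x' * y' * i (x' * y') := by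
  rw [h.one_mul_left, h.one_mul_right, h.one_mul_left x', h.one_mul_right _ y', hx, hy]

theorem one_one (x : S) : x * i x * i (x * i x) = x * i x :=
  h.one_eq_one (h.idem x) (by
    calc x * i x * i (x * i x) * x = x * i x * i (x * i x) * (x * i x * x) := by
          rw [h.mul_inv_mul]
      _ = x := by rw [← mul_assoc, h.mul_inv_mul, h.mul_inv_mul])

theorem one_mul_self (x : S) : x * x * i (x * x) = x * i x := by
  rw [h.one_mul_congr (h.one_one x).symm (h.one_one x).symm, h.idem, h.one_one]

theorem one_inv (x : S) : i x * i (i x) = x * i x :=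
  h.one_eq_one (by rw [← mul_assoc, h.inv_mul_inv]) (by
    calc i x * i (i x) * x = i x * i (i x) * (i x * x * x) := by rw [← h.comm, h.mul_inv_mul]
      _ = x := by rw [← mul_assoc, ← mul_assoc, h.mul_inv_mul, ← h.comm, h.mul_inv_mul])

/-- The congruence whose classes are the maximal subgroups. -/
def con : Con S where
  r x y := x * i x = y * i y
  iseqv := ⟨fun _ => rfl, Eq.symm, Eq.trans⟩
  mul' := h.one_mul_congr

end IsRigidCR

section RigidBand

variable {B : Type} [Semigroup B] (hB : ∀ x : B, x * x = x)
  (hcomm : ∀ e a b : B, e * a = a → a * e = a → e * b = b → b * e = b → a * b = b * a)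
include hB hcomm

/-- In a band whose local submonoids are commutative, an element below `b` whose
ideal contains `b` is `b`. -/
theorem band_eq_of_le_of_mem_ideal {a b s t : B} (hab : a * b = a) (hba : b * a = a)
    (hb : b = s * a * t) : a = b := by
  have h1 : b = b * s * b * (a * (b * t * b)) := by
    calc b = b * b * b := by rw [hB, hB]
      _ = b * (s * (b * a * b) * t) * b := by rw [hba, hab, ← hb]
      _ = _ := by simp only [mul_assoc]
  have h2 : a * (b * t * b) = b * t * b * a :=
    hcomm b _ _ hba hab (by simp only [← mul_assoc, hB]) (by simp only [mul_assoc, hB])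
  calc a = b * a := hba.symm
    _ = b * s * b * (b * t * b * a) * a := by rw [← h2, ← h1]
    _ = b * s * b * (b * t * b * a) := by simp only [mul_assoc, hB]
    _ = b := by rw [← h2, ← h1]

/-- Both sides generate the same ideal, since conjugate products such as `y * x * (z * x)` and
`z * x * (y * x)` do, and the left side lies below the right side. -/
theorem band_mul_mul_insert (x y z : B) : x * y * z * x = x * y * x * z * x := by
  have h1 : x * y * x * (x * y * z * x) = x * y * z * x := by
    calc x * y * x * (x * y * z * x) = x * y * (x * x) * y * z * x := by simp only [mul_assoc]
      _ = x * y * (x * y) * z * x := by rw [hB]; simp only [mul_assoc]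
      _ = x * y * z * x := by rw [hB]
  have h2 : x * y * z * x * (x * z * x) = x * y * z * x := by
    calc x * y * z * x * (x * z * x) = x * y * (z * (x * x) * (z * x)) := by
          simp only [mul_assoc]
      _ = x * y * (z * x * (z * x)) := by rw [hB]
      _ = x * y * z * x := by rw [hB]; simp only [mul_assoc]
  have h3 : x * y * x * z * x = x * y * x * (x * z * x) := by
    calc x * y * x * z * x = x * y * (x * x) * z * x := by rw [hB]
      _ = _ := by simp only [mul_assoc]
  have hl : ∀ w : B, x * (x * w) = x * w := fun w => by rw [← mul_assoc, hB]
  have hr : ∀ w : B, w * x * x = w * x := fun w => by rw [mul_assoc, hB]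
  have h4 : x * y * x * (x * y * z * x) = x * y * z * x * (x * y * x) :=
    hcomm x _ _ (by simp only [mul_assoc, hl]) (hr _) (by simp only [mul_assoc, hl]) (hr _)
  have h5 : x * y * z * x * (x * y * x * z * x) = x * y * z * x := by
    rw [h3, ← mul_assoc, ← h4, h1, h2]
  refine band_eq_of_le_of_mem_ideal hB hcomm h5 ?_
    (s := x * y * x * z) (t := y * z * x * y * x * z * x) ?_
  · nth_rewrite 2 [← h5]
    exact hcomm x _ _ (by simp only [mul_assoc, hl]) (hr _) (by simp only [mul_assoc, hl]) (hr _)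
  · symm
    calc x * y * x * z * (x * y * z * x) * (y * z * x * y * x * z * x)
        = x * y * x * (z * x * y * (z * x * y) * (z * x * y)) * x * z * x := by
          simp only [mul_assoc]
      _ = x * (y * x * z * x * (y * x * z * x)) := by rw [hB, hB]; simp only [mul_assoc]
      _ = x * y * x * z * x := by rw [hB]; simp only [mul_assoc]

theorem band_swap (x y z : B) : x * y * z * x = x * z * y * x := by
  have hl : ∀ w : B, x * (x * w) = x * w := fun w => by rw [← mul_assoc, hB]
  have hr : ∀ w : B, w * x * x = w * x := fun w => by rw [mul_assoc, hB]
  have h3 : ∀ y z : B, x * y * z * x = x * y * x * (x * z * x) := fun y z => by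
    calc x * y * z * x = x * y * x * z * x := band_mul_mul_insert hB hcomm x y z
      _ = x * y * (x * x) * z * x := by rw [hB]
      _ = _ := by simp only [mul_assoc]
  rw [h3 y z, h3 z y]
  exact hcomm x _ _ (by simp only [mul_assoc, hl]) (hr _) (by simp only [mul_assoc, hl]) (hr _)

/-- A band whose local submonoids are commutative is normal. -/
theorem band_normal (u x y v : B) : u * x * y * v = u * y * x * v := by
  have h1 : u * x * y * v * u = u * y * x * v * u := by
    calc u * x * y * v * u = u * (x * y) * v * u := by simp only [mul_assoc]
      _ = u * x * y * u * (v * u) := by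
        rw [band_mul_mul_insert hB hcomm]; simp only [mul_assoc]
      _ = u * (y * x) * u * v * u := by rw [band_swap hB hcomm]; simp only [mul_assoc]
      _ = _ := by rw [← band_mul_mul_insert hB hcomm]; simp only [mul_assoc]
  have h2 : v * u * x * y * v = v * u * y * x * v := by
    calc v * u * x * y * v = v * u * (x * y) * v := by simp only [mul_assoc]
      _ = v * u * (v * x * y * v) := by
        rw [band_mul_mul_insert hB hcomm]; simp only [mul_assoc]
      _ = v * u * v * (y * x) * v := by rw [band_swap hB hcomm]; simp only [mul_assoc]
      _ = _ := by rw [← band_mul_mul_insert hB hcomm]; simp only [mul_assoc]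
  calc u * x * y * v = u * x * y * v * (u * x * y * v) * (u * x * y * v) := by rw [hB, hB]
    _ = u * x * y * v * u * (x * y) * (v * u * x * y * v) := by simp only [mul_assoc]
    _ = u * y * x * v * u * (x * y) * (v * u * y * x * v) := by rw [h1, h2]
    _ = u * y * x * v * (u * x * y * v * u) * (y * x * v) := by simp only [mul_assoc]
    _ = u * y * x * v * (u * y * x * v) * (u * y * x * v) := by
      rw [h1]; simp only [mul_assoc]
    _ = u * y * x * v := by rw [hB, hB]

end RigidBand

theorem CR.exists_inv {S : Type} [Semigroup S] (h : CR S) :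
    ∃ i : S → S, (∀ x, x * i x = i x * x) ∧ (∀ x, x * i x * x = x) ∧ ∀ x, i x * x * i x = i x := by
  suffices ∀ x : S, ∃ y, x * y = y * x ∧ x * y * x = x ∧ y * x * y = y by
    choose i hi using this
    exact ⟨i, fun x => (hi x).1, fun x => (hi x).2.1, fun x => (hi x).2.2⟩
  intro x
  obtain ⟨H, hx, G, _, ⟨f⟩⟩ := h.2.2 x
  refine ⟨(f.symm (f ⟨x, hx⟩)⁻¹ : H), ?_, ?_, ?_⟩
  · exact congrArg Subtype.val (a₁ := ⟨x, hx⟩ * f.symm (f ⟨x, hx⟩)⁻¹)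
      (a₂ := f.symm (f ⟨x, hx⟩)⁻¹ * ⟨x, hx⟩) (f.injective (by simp))
  · exact congrArg Subtype.val (a₁ := ⟨x, hx⟩ * f.symm (f ⟨x, hx⟩)⁻¹ * ⟨x, hx⟩)
      (a₂ := ⟨x, hx⟩) (f.injective (by simp))
  · exact congrArg Subtype.val (a₁ := f.symm (f ⟨x, hx⟩)⁻¹ * ⟨x, hx⟩ * f.symm (f ⟨x, hx⟩)⁻¹)
      (a₂ := f.symm (f ⟨x, hx⟩)⁻¹) (f.injective (by simp))

/-- The elements whose subgroup has the identity `x * i x` form a group. -/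
theorem IsRigidCR.isGroupSemigroup {S : Type} [Semigroup S] {i : S → S} (h : IsRigidCR i)
    (H : Subsemigroup S) (x : S) (hH : ∀ y, y ∈ H ↔ y * i y = x * i x) : IsGroupSemigroup H := by
  let G : Group H :=
    { (inferInstance : Semigroup H) with
      one := ⟨x * i x, (hH _).2 (h.one_one x)⟩
      inv := fun y => ⟨i y, (hH _).2 ((h.one_inv y).trans ((hH y).1 y.2))⟩
      one_mul := fun y => Subtype.ext (by
        change x * i x * y = (y : S)
        rw [← (hH y).1 y.2, h.mul_inv_mul])
      mul_one := fun y => Subtype.ext (by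
        change (y : S) * (x * i x) = y
        rw [← (hH y).1 y.2, h.mul_self_mul_inv])
      inv_mul_cancel := fun y => Subtype.ext (by
        change i y * (y : S) = x * i x
        rw [← (hH y).1 y.2, h.comm]) }
  exact ⟨H, G, ⟨MulEquiv.refl H⟩⟩

theorem contained_normalBandsOfGroups {V : SemigroupClass} (hV : IsPseudovariety V)
    (hCR : V.Contained CR) (hL : ¬ LRB.Contained V) (hR : ¬ RRB.Contained V) :
    V.Contained NormalBandsOfGroups := by
  have hR' : ¬ LRB.Contained V.dual := fun h => hR (rrb_contained_of_lrb_contained_dual hV h)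
  have hleft : ∀ (S : Type) [Semigroup S], V S → LeftRigid S := fun S _ hS =>
    leftRigid_of_not_lrb_contained hV hL hS
  have hright : ∀ (S : Type) [Semigroup S], V S → LeftRigid Sᵐᵒᵖ := fun S _ hS =>
    leftRigid_of_not_lrb_contained hV.dual hR' (hV.image S Sᵐᵒᵖᵐᵒᵖ
      { toFun := fun x => .op (.op x), map_mul' := fun _ _ => rfl }
      (fun x => ⟨x.unop.unop, rfl⟩) hS)
  intro S _ hS
  obtain ⟨i, h1, h2, h3⟩ := (hCR S hS).exists_inv
  have h : IsRigidCR i := ⟨h1, h2, h3, hleft S hS, hright S hS⟩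
  have hVB : V h.con.Quotient :=
    hV.image S _ ⟨fun x => (x : h.con.Quotient), fun _ _ => rfl⟩ Quotient.mk_surjective hS
  have hB : ∀ x : h.con.Quotient, x * x = x := by
    rintro ⟨x⟩
    exact h.con.eq.2 (h.one_mul_self x)
  have hrB : IsRigidCR (id : h.con.Quotient → h.con.Quotient) :=
    ⟨fun _ => rfl, fun x => by simp [hB], fun x => by simp [hB], hleft _ hVB, hright _ hVB⟩
  have hnormal : ∀ u x y v : h.con.Quotient, u * x * y * v = u * y * x * v :=
    band_normal hB fun e a b ha ha' hb hb' => hrB.idem_comm (hB e) ha ha' hb hb' (hB a)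
  refine ⟨hV.finite S hS, hV.nonempty S hS, h.con.Quotient, inferInstance,
    ⟨hV.finite _ hVB, hV.nonempty _ hVB, hB, hnormal⟩,
    fun α => { carrier := {x | (x : h.con.Quotient) = α}, mul_mem' := ?_ }, ?_, ?_, ?_, ?_⟩
  · rintro x y rfl hy
    change ((x * y : S) : h.con.Quotient) = _
    rw [Con.coe_mul, show (y : h.con.Quotient) = x from hy, hB]
  · rintro ⟨x⟩
    exact h.isGroupSemigroup _ x fun y => h.con.eq
  · exact fun x => ⟨x, rfl⟩
  · intro α β hαβ
    exact Set.disjoint_left.2 fun x hx hx' => hαβ (hx.symm.trans hx')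
  · rintro α β x rfl y rfl
    rfl

/-! ### Programs in finite groups -/

section Group

variable {S : Type} [Semigroup S] {A T : Set S} {G : Type} [Group G] (ι : G →ₙ* S)

/-- Powers by repeated squaring. -/
theorem SLReach.map_pow {g : G} (hg : ι g ∈ T) (m : ℕ) (hm : 1 ≤ m) :
    SLReach A T (2 * Nat.log 2 m) (ι (g ^ m)) := by
  induction m using Nat.strong_induction_on with
  | _ m ih =>
    obtain rfl | hm2 := hm.eq_or_lt
    · simpa using SLReach.of_mem hg
    · obtain ⟨q, hq⟩ : ∃ q, q = m / 2 := ⟨_, rfl⟩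
      have hlog : Nat.log 2 m = Nat.log 2 q + 1 := hq ▸ Nat.log_of_one_lt_of_le one_lt_two hm2
      obtain ⟨U, hU, hgq⟩ := ih q (by omega) (by omega)
      have hsq := hU.mul hgq hgq
      rw [← map_mul, ← pow_add] at hsq
      rcases Nat.mod_two_eq_zero_or_one m with h | h
      · rw [show m = q + q by omega] at hlog ⊢
        exact SLReach.mono ⟨_, hsq, Set.mem_insert _ _⟩ (by omega)
      · have hmul := hsq.mul (Set.mem_insert _ _) (Set.mem_insert_of_mem _ (hU.subset hg))
        rw [← map_mul, ← pow_succ] at hmul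
        rw [show m = q + q + 1 by omega] at hlog ⊢
        exact SLReach.mono ⟨_, hmul, Set.mem_insert _ _⟩ (by omega)

variable [Finite G]

theorem SLReach.map_inv {g : G} (hg : ι g ∈ T) (h1 : ι 1 ∈ T) :
    SLReach A T (2 * Nat.log 2 (Nat.card G)) (ι g⁻¹) := by
  have hinv : g⁻¹ = g ^ (Nat.card G - 1) := by
    rw [inv_eq_iff_mul_eq_one, ← pow_succ', Nat.sub_add_cancel Nat.card_pos, pow_card_eq_one']
  rcases Nat.eq_zero_or_pos (Nat.card G - 1) with h | h
  · rw [hinv, h, pow_zero]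
    exact (SLReach.of_mem h1).mono (Nat.zero_le _)
  · rw [hinv]
    exact (SLReach.map_pow ι hg _ h).mono
      (Nat.mul_le_mul_left _ (Nat.log_mono_right (Nat.sub_le _ _)))

/-- A set `K` of `2 ^ i` elements such that from `T` each element of `K` and its inverse take at
most `i` further instructions. The `i`-dimensional cubes `{h₁ ^ ε₁ ⋯ hᵢ ^ εᵢ | ε ∈ {0, 1}ⁱ}` with
distinct vertices have this property if the `hⱼ` and their inverses belong to `T`. -/
structure IsReachCube (A T : Set S) (i : ℕ) (K : Finset G) : Prop where
  card : K.card = 2 ^ i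
  reach : ∀ k ∈ K, ∀ U, T ⊆ U → SLReach A U i (ι k)
  reach_inv : ∀ k ∈ K, ∀ U, T ⊆ U → SLReach A U i (ι k⁻¹)

variable {ι} {X : Set G} {c : ℕ}

theorem IsReachCube.le_log {i : ℕ} {K : Finset G} (hK : IsReachCube ι A T i K) :
    i ≤ Nat.log 2 (Nat.card G) := by
  have := Fintype.ofFinite G
  refine Nat.le_log_of_pow_le one_lt_two ?_
  rw [← hK.card, Nat.card_eq_fintype_card]
  exact Finset.card_le_univ K

/-- Unless the quotients `k⁻¹ * k'` of the elements of `K` exhaust the submonoid generated by `X`,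
some `h = k⁻¹ * k' * x` with `x ∈ X` is not such a quotient, and then `K` and `K * h` are
disjoint. -/
theorem IsReachCube.exists_succ {i : ℕ} {K : Finset G} (hK : IsReachCube ι A T i K)
    (h1 : ι 1 ∈ T) (hX : ∀ x ∈ X, ∀ U, T ⊆ U → SLReach A U c (ι x)) {g : G}
    (hg : g ∈ Submonoid.closure X) (hgK : ¬ ∃ k ∈ K, ∃ k' ∈ K, g = k⁻¹ * k') :
    ∃ (U : Set S) (K' : Finset G),
      SLExtends A T (4 * Nat.log 2 (Nat.card G) + c + 2) U ∧ IsReachCube ι A U (i + 1) K' := by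
  classical
  have hi := hK.le_log
  obtain ⟨k, hk, k', hk', x, hx, hxK⟩ : ∃ k ∈ K, ∃ k' ∈ K, ∃ x ∈ X,
      ¬ ∃ l ∈ K, ∃ l' ∈ K, k⁻¹ * k' * x = l⁻¹ * l' := by
    by_contra! hclosed
    refine hgK ?_
    clear hgK
    induction hg using Submonoid.closure_induction_right with
    | one =>
      obtain ⟨k, hk⟩ : K.Nonempty := Finset.card_pos.1 (by rw [hK.card]; positivity)
      exact ⟨k, hk, k, hk, by simp⟩
    | mul_right y _ x hx ih =>
      obtain ⟨k, hk, k', hk', rfl⟩ := ih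
      exact hclosed k hk k' hk' x hx
  have h2 : SLReach A T (2 * Nat.log 2 (Nat.card G) + c + 2) (ι (k⁻¹ * k' * x)) := by
    rw [map_mul, map_mul]
    exact (((hK.reach_inv k hk T subset_rfl).mul (hK.reach k' hk')).mul (hX x hx)).mono (by omega)
  obtain ⟨U₁, hU₁, hh₁⟩ := h2
  obtain ⟨U, hU, hhinv⟩ := SLReach.map_inv (A := A) ι hh₁ (hU₁.subset h1)
  have hh := hU.subset hh₁
  have hTU : T ⊆ U := hU₁.subset.trans hU.subset
  obtain ⟨h, hdef⟩ : ∃ h, h = k⁻¹ * k' * x := ⟨_, rfl⟩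
  rw [← hdef] at hh hhinv hxK
  refine ⟨U, K ∪ K.map (mulRightEmbedding h), (hU₁.trans hU).mono (by omega), ?_, ?_, ?_⟩
  · rw [Finset.card_union_of_disjoint, Finset.card_map, hK.card, pow_succ, mul_two]
    rw [Finset.disjoint_left]
    intro l hl hl'
    obtain ⟨l', hl'K, rfl⟩ := Finset.mem_map.1 hl'
    exact hxK ⟨l', hl'K, _, hl, by simp⟩
  · intro l hl W hW
    rcases Finset.mem_union.1 hl with hl | hl
    · exact (hK.reach l hl W (hTU.trans hW)).mono (Nat.le_succ i)
    · obtain ⟨l', hl', rfl⟩ := Finset.mem_map.1 hl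
      rw [mulRightEmbedding_apply, map_mul]
      exact (hK.reach l' hl' W (hTU.trans hW)).mul fun Y hY => .of_mem (hY (hW hh))
  · intro l hl W hW
    rcases Finset.mem_union.1 hl with hl | hl
    · exact (hK.reach_inv l hl W (hTU.trans hW)).mono (Nat.le_succ i)
    · obtain ⟨l', hl', rfl⟩ := Finset.mem_map.1 hl
      rw [mulRightEmbedding_apply, mul_inv_rev, map_mul]
      exact ((SLReach.of_mem (hW hhinv)).mul
        fun Y hY => hK.reach_inv l' hl' Y (hTU.trans (hW.trans hY))).mono (by omega)

/-- The reachability theorem of Babai and Szemerédi, for a finite group that is embedded in a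
semigroup: every element generated by `X` takes `O(log² |G|)` instructions if the elements of `X`
take boundedly many. -/
theorem SLReach.of_mem_closure (h1 : ι 1 ∈ T)
    (hX : ∀ x ∈ X, ∀ U, T ⊆ U → SLReach A U c (ι x)) {g : G} (hg : g ∈ Subgroup.closure X) :
    SLReach A T (Nat.log 2 (Nat.card G) * (4 * Nat.log 2 (Nat.card G) + c + 4) + 1) (ι g) := by
  rw [← Subgroup.mem_toSubmonoid, Subgroup.closure_toSubmonoid_of_finite] at hg
  obtain ⟨L, hL⟩ : ∃ L, L = Nat.log 2 (Nat.card G) := ⟨_, rfl⟩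
  rw [← hL]
  by_contra hneg
  suffices ∀ i, ∃ (U : Set S) (K : Finset G),
      SLExtends A T (i * (4 * L + c + 2)) U ∧ IsReachCube ι A U i K by
    obtain ⟨U, K, -, hK⟩ := this (L + 1)
    have := hK.le_log
    omega
  intro i
  induction i with
  | zero =>
    refine ⟨T, {1}, by simpa using .refl, by simp, ?_, ?_⟩
    · intro k hk U hU
      rw [Finset.mem_singleton.1 hk]
      exact .of_mem (hU h1)
    · intro k hk U hU
      rw [Finset.mem_singleton.1 hk, inv_one]
      exact .of_mem (hU h1)
  | succ i ih =>
    obtain ⟨U, K, hU, hK⟩ := ih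
    have hi := hK.le_log
    by_cases hgK : ∃ k ∈ K, ∃ k' ∈ K, g = k⁻¹ * k'
    · refine absurd ?_ hneg
      obtain ⟨k, hk, k', hk', rfl⟩ := hgK
      obtain ⟨W, hW, hkk⟩ := (hK.reach_inv k hk U subset_rfl).mul (hK.reach k' hk')
      rw [← map_mul] at hkk
      refine SLReach.mono ⟨W, hU.trans hW, hkk⟩ ?_
      have := Nat.mul_le_mul_right (4 * L + c + 2) (hL ▸ hi : i ≤ L)
      nlinarith
    · obtain ⟨W, K', hW, hK'⟩ := hK.exists_succ (hU.subset h1)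
        (fun x hx Y hY => hX x hx Y (hU.subset.trans hY)) hg hgK
      exact ⟨W, K', (hU.trans hW).mono (by rw [← hL]; exact le_of_eq (by ring)), hK'⟩

end Group

/-! ### Programs in normal bands of groups -/

/-- In a finite semilattice, every finite meet is a meet of logarithmically many of its terms: the
meets over the subsets of an irredundant set of terms are distinct. -/
theorem exists_subset_inf_eq {M α : Type} [SemilatticeInf M] [OrderTop M] [Finite M]
    (ψ : α → M) (s : Finset α) :
    ∃ s' ⊆ s, s'.inf ψ = s.inf ψ ∧ s'.card ≤ Nat.log 2 (Nat.card M) := by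
  classical
  obtain ⟨s', hs', hmin⟩ := (s.powerset.filter fun u => u.inf ψ = s.inf ψ).exists_min_image
    Finset.card ⟨s, by simp⟩
  rw [Finset.mem_filter, Finset.mem_powerset] at hs'
  refine ⟨s', hs'.1, hs'.2, Nat.le_log_of_pow_le one_lt_two ?_⟩
  have hsub : ∀ u ⊆ s', ∀ v ⊆ s', u.inf ψ = v.inf ψ → u ⊆ v := by
    intro u hu v hv huv a ha
    by_contra hav
    have h1 : (s'.erase a).inf ψ ≤ ψ a :=
      (Finset.inf_mono fun x hx => Finset.mem_erase.2 ⟨by rintro rfl; exact hav hx, hv hx⟩).trans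
        (huv ▸ Finset.inf_le ha)
    have h2 : (s'.erase a).inf ψ = s.inf ψ := by
      rw [← hs'.2]
      conv_rhs => rw [← Finset.insert_erase (hu ha), Finset.inf_insert]
      exact (inf_eq_right.2 h1).symm
    have h3 := hmin (s'.erase a) (Finset.mem_filter.2
      ⟨Finset.mem_powerset.2 ((Finset.erase_subset _ _).trans hs'.1), h2⟩)
    exact absurd (Finset.card_erase_lt_of_mem (hu ha)) (not_lt.2 h3)
  have hinj : Function.Injective fun u : s'.powerset => (u : Finset α).inf ψ := fun u v huv =>
    Subtype.ext ((hsub _ (Finset.mem_powerset.1 u.2) _ (Finset.mem_powerset.1 v.2) huv).antisymm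
      (hsub _ (Finset.mem_powerset.1 v.2) _ (Finset.mem_powerset.1 u.2) huv.symm))
  simpa [-Finset.mem_powerset] using Nat.card_le_card_of_injective _ hinj

/-- For `c` and `d` in a normal band `B`, the products `c * x * d` form a semilattice with greatest
element `c * d`, and `x ↦ c * x * d` is a homomorphism. -/
theorem exists_semilattice_of_normal {B : Type} [Semigroup B] [Finite B] (hB : ∀ x : B, x * x = x)
    (hn : ∀ u x y v : B, u * x * y * v = u * y * x * v) (c d : B) :
    ∃ (M : Type) (_ : SemilatticeInf M) (_ : OrderTop M) (_ : Finite M) (ψ : B → M),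
      Nat.card M ≤ Nat.card B ∧ (∀ x y, ψ (x * y) = ψ x ⊓ ψ y) ∧ ψ c = ⊤ ∧
      ∀ x y, ψ x = ψ y → c * x * d = c * y * d := by
  let M := {z : B // c * z = z ∧ z * d = z}
  let _ : Min M := ⟨fun z w => ⟨z.1 * w.1, by rw [← mul_assoc, z.2.1], by rw [mul_assoc, w.2.2]⟩⟩
  let _ : SemilatticeInf M := SemilatticeInf.mk'
    (fun z w => Subtype.ext (by
      calc z.1 * w.1 = c * z.1 * w.1 * d := by rw [z.2.1, mul_assoc, w.2.2]
        _ = c * w.1 * z.1 * d := hn _ _ _ _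
        _ = w.1 * z.1 := by rw [w.2.1, mul_assoc, z.2.2]))
    (fun z w v => Subtype.ext (mul_assoc _ _ _)) (fun z => Subtype.ext (hB _))
  let _ : OrderTop M :=
    { top := ⟨c * d, by rw [← mul_assoc, hB], by rw [mul_assoc, hB]⟩
      le_top := fun z => by
        rw [← inf_eq_left]
        refine Subtype.ext ?_
        calc z.1 * (c * d) = c * z.1 * c * d := by rw [z.2.1, mul_assoc]
          _ = c * c * z.1 * d := hn _ _ _ _
          _ = z.1 := by rw [hB, z.2.1, z.2.2] }
  refine ⟨M, inferInstance, inferInstance, inferInstance,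
    fun x => ⟨c * x * d, by simp only [← mul_assoc, hB], by rw [mul_assoc, hB]⟩,
    Nat.card_le_card_of_injective _ Subtype.val_injective, fun x y => Subtype.ext ?_,
    Subtype.ext ?_, fun x y hxy => congrArg Subtype.val hxy⟩
  · change c * (x * y) * d = c * x * d * (c * y * d)
    calc c * (x * y) * d = c * c * (x * y * d) * d := by
          simp only [hB, mul_assoc]
      _ = c * (x * y * d) * c * d := hn _ _ _ _
      _ = c * (x * y) * (d * c) * d := by simp only [mul_assoc]
      _ = c * (d * c) * (x * y) * d := hn _ _ _ _
      _ = c * (d * c) * x * (y * d) := by simp only [mul_assoc]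
      _ = c * x * (d * c) * (y * d) := hn _ _ _ _
      _ = c * x * d * (c * y * d) := by simp only [mul_assoc]
  · change c * c * d = c * d
    rw [hB]

/-- A normal band of groups, in terms of the homomorphism onto the band whose fibres are the
groups. -/
theorem NormalBandsOfGroups.exists_hom {S : Type} [Semigroup S] (h : NormalBandsOfGroups S) :
    ∃ (B : Type) (_ : Semigroup B) (φ : S →ₙ* B), Finite B ∧ Nat.card B ≤ Nat.card S ∧
      (∀ x : B, x * x = x) ∧ (∀ u x y v : B, u * x * y * v = u * y * x * v) ∧
      ∀ b, ∃ (G : Type) (_ : Group G) (ι : G →ₙ* S), Function.Injective ι ∧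
        ∀ x, φ x = b ↔ ∃ g, ι g = x := by
  obtain ⟨hfin, -, B, _, ⟨hBfin, -, hB, hn⟩, H, hG, hcov, hdisj, hmul⟩ := h
  choose φ hφ using hcov
  have hmem : ∀ x b, φ x = b ↔ x ∈ H b := by
    refine fun x b => ⟨fun h => h ▸ hφ x, fun h => ?_⟩
    by_contra hne
    exact Set.disjoint_left.1 (hdisj _ _ hne) (hφ x) h
  refine ⟨B, inferInstance, ⟨φ, fun x y => (hmem _ _).2 (hmul _ _ _ (hφ x) _ (hφ y))⟩, hBfin,
    Nat.card_le_card_of_surjective φ fun b => ?_, hB, hn, fun b => ?_⟩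
  · obtain ⟨G, _, ⟨f⟩⟩ := hG b
    exact ⟨f.symm 1, (hmem _ _).2 (f.symm 1).2⟩
  · obtain ⟨G, _, ⟨f⟩⟩ := hG b
    refine ⟨G, inferInstance, ⟨fun g => (f.symm g : S), fun g g' => by simp⟩,
      fun g g' hgg => f.symm.injective (Subtype.ext hgg), fun x => ?_⟩
    refine (hmem x b).trans ⟨fun hx => ⟨f ⟨x, hx⟩, by simp⟩, ?_⟩
    rintro ⟨g, rfl⟩
    exact (f.symm g).2

section NormalBand

variable {S B : Type} [Semigroup S] [Semigroup B] (φ : S →ₙ* B) (hB : ∀ x : B, x * x = x)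
  (hn : ∀ u x y v : B, u * x * y * v = u * y * x * v)
include hB hn

/-- An element is generated by the generators that its class absorbs, and its class has a first and
a last generator. -/
theorem mem_closure_absorbed {A : Set S} {t : S} (ht : t ∈ Subsemigroup.closure A) :
    t ∈ Subsemigroup.closure {a ∈ A | φ t * φ a * φ t = φ t} ∧
      (∃ c ∈ A, φ c * φ t = φ t) ∧ ∃ d ∈ A, φ t * φ d = φ t := by
  induction ht using Subsemigroup.closure_induction with
  | mem a ha =>
    exact ⟨Subsemigroup.subset_closure ⟨ha, by rw [hB, hB]⟩, ⟨a, ha, hB _⟩, a, ha, hB _⟩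
  | mul x y _ _ hx hy =>
    obtain ⟨hx, ⟨c, hc, hcx⟩, -⟩ := hx
    obtain ⟨hy, -, d, hd, hdy⟩ := hy
    refine ⟨mul_mem (Subsemigroup.closure_mono ?_ hx) (Subsemigroup.closure_mono ?_ hy),
      ⟨c, hc, by rw [map_mul, ← mul_assoc, hcx]⟩, d, hd, by rw [map_mul, mul_assoc, hdy]⟩
    · rintro a ⟨ha, hxa⟩
      refine ⟨ha, ?_⟩
      rw [map_mul]
      calc φ x * φ y * φ a * (φ x * φ y) = φ x * φ y * (φ a * φ x) * φ y := by
            simp only [mul_assoc]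
        _ = φ x * (φ a * φ x) * φ y * φ y := hn _ _ _ _
        _ = φ x * φ y := by rw [← mul_assoc, hxa, mul_assoc, hB]
    · rintro a ⟨ha, hya⟩
      refine ⟨ha, ?_⟩
      rw [map_mul]
      calc φ x * φ y * φ a * (φ x * φ y) = φ x * (φ y * φ a) * φ x * φ y := by
            simp only [mul_assoc]
        _ = φ x * φ x * (φ y * φ a) * φ y := hn _ _ _ _
        _ = φ x * φ y := by rw [hB, mul_assoc, hya]

/-- A short program reaches the class of `t` in the band: between the first and the last generator,
logarithmically many generators suffice. -/
theorem exists_slReach_class [Finite B] {A : Set S} {t : S} (ht : t ∈ Subsemigroup.closure A) :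
    ∃ e, φ e = φ t ∧ SLReach A ∅ (2 * Nat.log 2 (Nat.card B) + 3) e := by
  classical
  obtain ⟨-, ⟨c, hc, hct⟩, d, hd, hdt⟩ := mem_closure_absorbed φ hB hn ht
  obtain ⟨M, _, _, _, ψ, hcard, hψ, hψc, hψinj⟩ := exists_semilattice_of_normal hB hn (φ c) (φ d)
  obtain ⟨s₀, hs₀, hts₀⟩ : ∃ s : Finset S, (s : Set S) ⊆ A ∧ ψ (φ t) = s.inf fun a => ψ (φ a) := by
    clear hct hdt
    induction ht using Subsemigroup.closure_induction with
    | mem a ha => exact ⟨{a}, by simpa using ha, by simp⟩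
    | mul x y _ _ hx hy =>
      obtain ⟨s, hs, hxs⟩ := hx
      obtain ⟨s', hs', hys⟩ := hy
      exact ⟨s ∪ s', by simpa using ⟨hs, hs'⟩, by rw [map_mul, hψ, hxs, hys, Finset.inf_union]⟩
  obtain ⟨s, hss, hs, hscard⟩ := exists_subset_inf_eq (fun a => ψ (φ a)) s₀
  have hsA : (s : Set S) ⊆ A := (Finset.coe_subset.2 hss).trans hs₀
  rw [← hs] at hts₀
  obtain ⟨y, hy1, hy2, hy3⟩ : ∃ y, φ c * φ y = φ y ∧ ψ (φ y) = s.inf (fun a => ψ (φ a)) ∧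
      SLReach A ∅ (2 * s.card + 1) y := by
    clear hss hs hscard hts₀
    induction s using Finset.induction_on with
    | empty => exact ⟨c, hB _, by simpa using hψc, .of_gen hc⟩
    | insert a s has ih =>
      obtain ⟨y, hy1, hy2, hy3⟩ := ih (fun x hx => hsA (by simpa using Or.inr hx))
      refine ⟨y * a, by rw [map_mul, ← mul_assoc, hy1], ?_, ?_⟩
      · rw [map_mul, hψ, hy2, Finset.inf_insert, inf_comm]
      · rw [Finset.card_insert_of_notMem has]
        exact (hy3.mul fun _ _ => .of_gen (hsA (by simp))).mono (by omega)
  refine ⟨y * d, ?_, (hy3.mul fun _ _ => .of_gen hd).mono ?_⟩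
  · rw [map_mul, ← hy1, hψinj _ _ (hy2.trans hts₀.symm), hct, hdt]
  · have := hscard.trans (Nat.log_mono_right hcard)
    omega

/-- Let `f` be the identity of the group over `b`. For a product `y` of elements of `X`, all of
which `b` absorbs, `f * y * f` belongs to the subgroup generated by the elements `f * a * f` and
`f * a * a' * f` with `a, a' ∈ X`. For, if `z` has the last factor `a`, then
`f * z * y * f = (f * z * f) * (f * a * f)⁻¹ * (f * a * y * f)`. -/
theorem exists_mem_closure_sandwich
    (hgroup : ∀ b, ∃ (G : Type) (_ : Group G) (ι : G →ₙ* S), Function.Injective ι ∧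
      ∀ x, φ x = b ↔ ∃ g, ι g = x)
    {G : Type} [Group G] (ι : G →ₙ* S) {b : B} (hι : ∀ x, φ x = b ↔ ∃ g, ι g = x)
    {X : Set S} (hX : ∀ a ∈ X, b * φ a * b = b) {y : S} (hy : y ∈ Subsemigroup.closure X) :
    ∃ g ∈ Subgroup.closure {g | ∃ a ∈ X, ι g = ι 1 * a * ι 1 ∨
      ∃ a' ∈ X, ι g = ι 1 * a * a' * ι 1}, ι g = ι 1 * y * ι 1 := by
  obtain ⟨Γ, hΓ⟩ : ∃ Γ, Γ = Subgroup.closure {g | ∃ a ∈ X, ι g = ι 1 * a * ι 1 ∨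
      ∃ a' ∈ X, ι g = ι 1 * a * a' * ι 1} := ⟨_, rfl⟩
  rw [← hΓ]
  have hf : φ (ι 1) = b := (hι _).2 ⟨1, rfl⟩
  have h1 : ∀ a ∈ X, ∃ g ∈ Γ, ι g = ι 1 * a * ι 1 := by
    intro a ha
    obtain ⟨g, hg⟩ := (hι (ι 1 * a * ι 1)).1 (by rw [map_mul, map_mul, hf, hX a ha])
    exact ⟨g, hΓ ▸ Subgroup.subset_closure ⟨a, ha, .inl hg⟩, hg⟩
  have hab : ∀ a ∈ X, ∀ v, b * φ a * v = b * v := by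
    intro a ha v
    calc b * φ a * v = b * b * φ a * v := by rw [hB]
      _ = b * φ a * b * v := hn _ _ _ _
      _ = b * v := by rw [hX a ha]
  let E : S → Prop := fun z => (∃ a ∈ X, b * φ z = b * φ a) ∧ ∃ g ∈ Γ, ι g = ι 1 * z * ι 1
  have step : ∀ z, E z → ∀ y ∈ X, E (z * y) := by
    rintro z ⟨⟨a, ha, hza⟩, g, hg, hgz⟩ y hy
    refine ⟨⟨y, hy, by rw [map_mul, ← mul_assoc, hza, hab a ha]⟩, ?_⟩
    obtain ⟨ga, hga, hgaa⟩ := h1 a ha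
    obtain ⟨gy, hgy⟩ := (hι (ι 1 * a * y * ι 1)).1 (by
      rw [map_mul, map_mul, map_mul, hf, mul_assoc, hab a ha, ← mul_assoc, hX y hy])
    have hgyΓ : gy ∈ Γ := hΓ ▸ Subgroup.subset_closure ⟨a, ha, .inr ⟨y, hy, hgy⟩⟩
    refine ⟨g * ga⁻¹ * gy, mul_mem (mul_mem hg (inv_mem hga)) hgyΓ, ?_⟩
    obtain ⟨r, hr⟩ : ∃ r, r = ι ga⁻¹ := ⟨_, rfl⟩
    have hrb : φ r = b := (hι _).2 ⟨_, hr.symm⟩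
    have hfr : ι 1 * r = r := by rw [hr, ← map_mul, one_mul]
    have hrf : r * ι 1 = r := by rw [hr, ← map_mul, mul_one]
    -- Both `ι 1 * z` and the idempotent `r * a` lie in the group over `b * φ a`.
    have hidem : r * a * (r * a) = r * a := by
      calc r * a * (r * a) = r * (ι 1 * a * ι 1) * r * a := by
            simp only [← mul_assoc, hrf]
            rw [mul_assoc _ (ι 1) r, hfr]
        _ = r * a := by rw [← hgaa, hr, ← map_mul, ← map_mul, inv_mul_cancel, one_mul]
    have hzra : ι 1 * z * (r * a) = ι 1 * z := by
      obtain ⟨G', _, ι', hinj, hι'⟩ := hgroup (b * φ a)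
      obtain ⟨p, hp⟩ := (hι' (ι 1 * z)).1 (by rw [map_mul, hf, hza])
      obtain ⟨q, hq⟩ := (hι' (r * a)).1 (by rw [map_mul, hrb])
      have hq1 : q = 1 := by
        rw [← hq, ← map_mul] at hidem
        exact mul_eq_left.1 (hinj hidem)
      rw [← hp, ← hq, ← map_mul, hq1, mul_one]
    calc ι (g * ga⁻¹ * gy) = ι 1 * z * ι 1 * r * (ι 1 * a * y * ι 1) := by
          rw [map_mul, map_mul, hgz, hgy, hr]
      _ = ι 1 * z * (ι 1 * r * ι 1 * a) * y * ι 1 := by simp only [mul_assoc]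
      _ = ι 1 * (z * y) * ι 1 := by rw [hfr, hrf, hzra]; simp only [mul_assoc]
  suffices E y ∧ ∀ z, E z → E (z * y) from this.1.2
  induction hy using Subsemigroup.closure_induction with
  | mem a ha => exact ⟨⟨⟨a, ha, rfl⟩, h1 a ha⟩, fun z hz => step z hz a ha⟩
  | mul x y _ _ hx hy => exact ⟨hy.2 _ hx.1, fun z hz => by
      rw [← mul_assoc]; exact hy.2 _ (hx.2 z hz)⟩

end NormalBand

theorem NormalBandsOfGroups.slCostMax_le {S : Type} [Semigroup S] (h : NormalBandsOfGroups S)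
    {N : ℕ} (hN : 2 ≤ N) (hS : Nat.card S ≤ N) :
    slCostMax ⊤ S ≤ (21 * Nat.log 2 N ^ 2 : ℕ) := by
  have := h.1
  obtain ⟨B, _, φ, _, hBS, hB, hn, hgroup⟩ := h.exists_hom
  refine iSup_le fun A => iSup_le fun t => iSup_le fun ht => ?_
  obtain ⟨L, hL⟩ : ∃ L, L = Nat.log 2 N := ⟨_, rfl⟩
  have hL1 : 1 ≤ L := hL ▸ Nat.log_pos one_lt_two hN
  obtain ⟨e, he, U, hU, heU⟩ := exists_slReach_class φ hB hn ht
  obtain ⟨G, _, ι, hinj, hι⟩ := hgroup (φ t)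
  have : Finite G := Finite.of_injective ι hinj
  have hGL : Nat.log 2 (Nat.card G) ≤ L :=
    hL ▸ Nat.log_mono_right ((Nat.card_le_card_of_injective ι hinj).trans hS)
  have hBL : Nat.log 2 (Nat.card B) ≤ L := hL ▸ Nat.log_mono_right (hBS.trans hS)
  obtain ⟨g, rfl⟩ := (hι e).1 he
  obtain ⟨W, hW, h1⟩ := SLReach.map_pow (A := A) ι heU (Nat.card G) Nat.card_pos
  rw [pow_card_eq_one'] at h1
  have hmem := (mem_closure_absorbed φ hB hn ht).1
  obtain ⟨g', hg', hgt⟩ := exists_mem_closure_sandwich φ hB hn hgroup ι hι (fun a ha => ha.2) hmem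
  obtain ⟨p, hp⟩ := (hι t).1 rfl
  rw [← hp, ← map_mul, ← map_mul, one_mul, mul_one, hp] at hgt
  obtain ⟨Y, hY, htY⟩ := SLReach.of_mem_closure (A := A) (c := 5) h1 (by
    have hgen : ∀ a ∈ A, ∀ U, W ⊆ U → SLReach A U 2 (ι 1 * a) := fun a ha U hU =>
      (SLReach.of_mem (hU h1)).mul fun _ _ => .of_gen ha
    rintro x ⟨a, ha, hx | ⟨a', ha', hx⟩⟩ U hU
    · rw [hx]
      exact ((hgen a ha.1 U hU).mul fun V hV => .of_mem (hV (hU h1))).mono (by norm_num)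
    · rw [hx]
      exact ((hgen a ha.1 U hU).mul fun V hV => .of_gen ha'.1).mul
        fun V hV => .of_mem (hV (hU h1))) hg'
  rw [hgt] at htY
  refine (SLReach.slCost_le ⟨Y, (hU.trans hW).trans hY, htY⟩).trans ?_
  rw [← hL]
  norm_cast
  have h2 := Nat.mul_le_mul hGL (show 4 * Nat.log 2 (Nat.card G) + 5 + 4 ≤ 4 * L + 9 by omega)
  nlinarith

theorem admitsSLP_of_contained_normalBandsOfGroups {V : SemigroupClass}
    (h : V.Contained NormalBandsOfGroups) : V.AdmitsSLP ⊤ fun N => Real.log N ^ 2 := by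
  refine ⟨21 / Real.log 2 ^ 2, Filter.eventually_atTop.2 ⟨2, fun N hN => ?_⟩⟩
  have h1 : V.slCost ⊤ N ≤ (21 * Nat.log 2 N ^ 2 : ℕ) :=
    iSup_le fun S => iSup_le fun _ => iSup_le fun hS => iSup_le fun hcard =>
      (h S hS).slCostMax_le hN hcard
  have h2 : ((V.slCost ⊤ N : ℕ∞) : ℝ≥0∞) ≤ ((21 * Nat.log 2 N ^ 2 : ℕ) : ℝ≥0∞) := by
    exact_mod_cast h1
  refine h2.trans ?_
  rw [← ENNReal.ofReal_natCast]
  refine ENNReal.ofReal_le_ofReal ?_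
  have hlog : (Nat.log 2 N : ℝ) ≤ Real.log N / Real.log 2 := Real.natLog_le_logb N 2
  rw [abs_of_nonneg (by positivity), div_mul_eq_mul_div, mul_div_assoc, ← div_pow]
  push_cast
  gcongr

theorem mainTheorem8 (V : SemigroupClass) (hV : IsPseudovariety V)
    (hCR : V.Contained CR) :
    List.TFAE [
      V.EfficientCompression,
      ¬ LRB.Contained V ∧ ¬ RRB.Contained V,
      V.Contained NormalBandsOfGroups,
      V.AdmitsSLP ⊤ (fun N => Real.log N ^ 2)] := by
  tfae_have 1 → 2 := not_contained_of_efficientCompression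
  tfae_have 2 → 3 := fun h => contained_normalBandsOfGroups hV hCR h.1 h.2
  tfae_have 3 → 4 := admitsSLP_of_contained_normalBandsOfGroups
  tfae_have 4 → 1 := fun h => ⟨2, h⟩
  tfae_finish
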